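/- Words are over the alphabet $\{0,1\}$. For an infinite word $\mathbf{y}$ let $\mathrm{Fac}_n(\mathbf{y})$ be its set of factors of length $n$, $\mathrm{p}_{\mathbf{y}}(n)=\#\mathrm{Fac}_n(\mathbf{y})$, and $\Psi(u)=(|u|_0,|u|_1)$ the Parikh vector of a finite word $u$. For finite words $u,w$, let $\binom{u}{w}$ be the number of occurrences of $w$ as a (scattered) subword of $u$; write $u\sim_k v$ if $\binom{u}{w}=\binom{v}{w}$ for all words $w$ of length at most $k$. The $k$-binomial complexity of $\mathbf{y}$ is $\mathrm{b}^{(k)}_{\mathbf{y}}(n)=\#(\mathrm{Fac}_n(\mathbf{y})/{\sim_k})$; $\mathrm{b}^{(1)}_{\mathbf{y}}$ is the abelian complexity. Let $\varphi\colon 0\mapsto 01,\ 1\mapsto 10$ be the Thue--Morse morphism and $\mathbf{t}=01101001\cdots$ the Thue--Morse word. Put \begin{align*} X_{\mathbf{y}}(n)&=\{(a,\Psi(u),b): a,b\in\{0,1\},\ aub\in \mathrm{Fac}_{n+1}(\mathbf{y})\},\\ Y_{\mathbf{y},L}(n)&=\{(a,\Psi(u)): a\in\{0,1\},\ au\in \mathrm{Fac}_{n+1}(\mathbf{y})\},\\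 Y_{\mathbf{y},R}(n)&=\{(\Psi(u),a): a\in\{0,1\},\ ua\in \mathrm{Fac}_{n+1}(\mathbf{y})\}, \end{align*} and let $Y_{\mathbf{y}}(n)$ be the (disjoint) union of $Y_{\mathbf{y},L}(n)$ and $Y_{\mathbf{y},R}(n)$. **Proposition.** Let $\mathbf{y}$ be an infinite binary word, let $k\ge 1$ and $\mathbf{x}=\varphi^k(\mathbf{y})$. Let $m=\max\{n\in\mathbb{N}: 0^n \text{ and } 1^n \text{ are factors of } \mathbf{y}\}$ and $m'=\max\{n\in\mathbb{N}: 0^n \text{ or } 1^n \text{ is a factor of } \mathbf{y}\}$, where $m$ and $m'$ may be $\infty$. (1) If $\mathbf{y}$ is aperiodic (that is, not ultimately periodic), then $\mathrm{b}^{(k+1)}_{\mathbf{x}}(r)=\mathrm{p}_{\mathbf{t}}(r)$ for all $0\le r<2^k$. (2) For all $n\ge 1$, $$\mathrm{b}^{(k+1)}_{\mathbf{x}}(2^k n)=(2^k-1)\,\#X_{\mathbf{y}}(n)+\mathrm{b}^{(1)}_{\mathbf{y}}(n)-\begin{cases}2^k, & \text{if } n<m;\\ 1, & \text{if } n=m<m';\\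 0, & \text{otherwise.}\end{cases}$$ (3) For all $n\ge 1$ and $0<r<2^k$, $$\mathrm{b}^{(k+1)}_{\mathbf{x}}(2^k n+r)=(r-1)\,\#X_{\mathbf{y}}(n+1)+(2^k-r-1)\,\#X_{\mathbf{y}}(n)+\#Y_{\mathbf{y}}(n)-\begin{cases}2^k, & \text{if } n+1<m;\\ 2^k-r+1, & \text{if } n+1=m<m';\\ 2^k-2(r-1), & \text{if } n+1=m=m' \text{ and } r\le 2^{k-1};\\ 0, & \text{otherwise.}\end{cases}$$ -/

import Mathlib

namespace BinomialWords

/-- The factor `x_i x_{i+1} ⋯ x_{i+n-1}` of length `n` of the infinite word `x`. -/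
def factorAt {A : Type*} (x : ℕ → A) (i n : ℕ) : List A :=
  (List.range n).map fun j => x (i + j)

/-- `Fac_n(x)`: the set of factors of length `n` of the infinite word `x`. -/
def factors {A : Type*} (x : ℕ → A) (n : ℕ) : Set (List A) :=
  Set.range fun i => factorAt x i n

/-- The factor complexity `n ↦ #Fac_n(x)`. -/
noncomputable def factorComplexity {A : Type*} (x : ℕ → A) (n : ℕ) : ℕ :=
  (factors x n).ncard

/-- The binomial coefficient of the words `u` and `w`: the number of times `w` occurs as a subword
(subsequence) of `u`. The list `u.sublists` holds one entry for each set of positions of `u`. -/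
def binom {A : Type*} [DecidableEq A] (u w : List A) : ℕ :=
  u.sublists.count w

/-- `k`-binomial equivalence `u ∼_k v`. -/
def binomSetoid (A : Type*) [DecidableEq A] (k : ℕ) : Setoid (List A) where
  r u v := ∀ w : List A, w.length ≤ k → binom u w = binom v w
  iseqv := ⟨fun _ _ _ => rfl, fun h w hw => (h w hw).symm,
    fun h₁ h₂ w hw => (h₁ w hw).trans (h₂ w hw)⟩

/-- The `k`-binomial complexity of `x`: the number of classes of `∼_k` that are represented by
factors of `x` of length `n`. For `k = 1` it is the abelian complexity. -/
noncomputable def binomComplexity {A : Type*} [DecidableEq A] (k : ℕ) (x : ℕ → A) (n : ℕ) : ℕ :=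
  ((fun u => Quotient.mk (binomSetoid A k) u) '' factors x n).ncard

/-- `x` is aperiodic, that is, not ultimately periodic. -/
def Aperiodic {A : Type*} (x : ℕ → A) : Prop :=
  ¬ ∃ p N : ℕ, 0 < p ∧ ∀ n, N ≤ n → x (n + p) = x n

/-- The Thue–Morse morphism `φ : 0 ↦ 01, 1 ↦ 10` on infinite binary words: the letters of
`φ(y)` at the positions `2i` and `2i + 1` are `y_i` and its complement `1 - y_i`. -/
def thueMorseMorphism (y : ℕ → Fin 2) : ℕ → Fin 2 := fun n =>
  if n % 2 = 0 then y (n / 2) else 1 - y (n / 2)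

/-- The Thue–Morse word `t = 01101001⋯`: its `n`-th letter is the parity of the number of ones in
the binary expansion of `n`. -/
def thueMorseWord : ℕ → Fin 2 := fun n => Fin.ofNat 2 (Nat.digits 2 n).sum

/-- The Thue–Morse word is a fixed point of the Thue–Morse morphism. -/
theorem thueMorseMorphism_thueMorseWord :
    thueMorseMorphism thueMorseWord = thueMorseWord := by
  funext n
  rcases Nat.eq_zero_or_pos n with rfl | hn
  · simp [thueMorseMorphism]
  · have h : (Nat.digits 2 n).sum = n % 2 + (Nat.digits 2 (n / 2)).sum := by
      rw [Nat.digits_def' (by norm_num) hn, List.sum_cons]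
    have h2 := Nat.mod_two_eq_zero_or_one n
    ext
    simp only [thueMorseMorphism, thueMorseWord, h]
    rcases h2 with h2 | h2
    · simp [h2]
    · simp only [h2, one_ne_zero, if_false, Fin.ofNat, Fin.sub_def]
      simp only [Fin.val_one]
      omega

/-- The Parikh vector of a binary word. -/
def parikh (u : List (Fin 2)) : Fin 2 → ℕ := fun a => u.count a

/-- `X_y(n) = {(a, Ψ(u), b) : aub ∈ Fac_{n+1}(y)}`. -/
def setX (y : ℕ → Fin 2) (n : ℕ) : Set (Fin 2 × (Fin 2 → ℕ) × Fin 2) :=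
  {q | ∃ (a : Fin 2) (u : List (Fin 2)) (b : Fin 2),
    a :: (u ++ [b]) ∈ factors y (n + 1) ∧ q = (a, parikh u, b)}

/-- `Y_{y,L}(n) = {(a, Ψ(u)) : au ∈ Fac_{n+1}(y)}`. -/
def setYL (y : ℕ → Fin 2) (n : ℕ) : Set (Fin 2 × (Fin 2 → ℕ)) :=
  {q | ∃ (a : Fin 2) (u : List (Fin 2)), a :: u ∈ factors y (n + 1) ∧ q = (a, parikh u)}

/-- `Y_{y,R}(n) = {(Ψ(u), a) : ua ∈ Fac_{n+1}(y)}`. -/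
def setYR (y : ℕ → Fin 2) (n : ℕ) : Set ((Fin 2 → ℕ) × Fin 2) :=
  {q | ∃ (u : List (Fin 2)) (a : Fin 2), u ++ [a] ∈ factors y (n + 1) ∧ q = (parikh u, a)}

/-- `Y_y(n) = Y_{y,L}(n) ∪ Y_{y,R}(n)`. The elements of the two sets are pairs of different kinds
(letter, vector) and (vector, letter), so the union is disjoint. -/
def setY (y : ℕ → Fin 2) (n : ℕ) : Set ((Fin 2 × (Fin 2 → ℕ)) ⊕ ((Fin 2 → ℕ) × Fin 2)) :=
  Sum.inl '' setYL y n ∪ Sum.inr '' setYR y n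

/-- `m = max {n : 0^n and 1^n are factors of y}`, possibly infinite. -/
noncomputable def maxBothPowers (y : ℕ → Fin 2) : ℕ∞ :=
  sSup ((fun n : ℕ => (n : ℕ∞)) ''
    {n | List.replicate n 0 ∈ factors y n ∧ List.replicate n 1 ∈ factors y n})

/-- `m' = max {n : 0^n or 1^n is a factor of y}`, possibly infinite. -/
noncomputable def maxSomePower (y : ℕ → Fin 2) : ℕ∞ :=
  sSup ((fun n : ℕ => (n : ℕ∞)) ''
    {n | List.replicate n 0 ∈ factors y n ∨ List.replicate n 1 ∈ factors y n})

end BinomialWords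

open BinomialWords

namespace BinomialWords

/-! ### Binomial coefficients of words -/

section Binom

variable {A : Type*} [DecidableEq A]

/-! A factor of φ^k(y) has the form p φ^k(u) q, where p is a proper suffix and q a proper prefix of
images of at most one letter each. Two facts govern its (k+1)-binomial class.

Sufficiency: φ^k(0) ∼_k φ^k(1), and ∼_k-equivalent words commute up to ∼_{k+1}. So the class depends
only on p, q and the Parikh vector of u (`subst_iterate_binomEquiv_of_perm`,
`binomEquiv_of_windowData_eq`).

Necessity: ∼_K preserves the signed moments Σ ± t^e for e < K, where t counts the letters to the
right (`BinomEquiv.momentEq`). Replacing φ(u) by u costs one moment (`MomentEq.of_subst`). Comparing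
two factors one level of φ at a time, the moments of order 0 and 1 force either equal boundary
letters, which can be stripped, or literal equality (`MomentEq.eq_or_of_append_subst_append`). After
k levels one moment is left, which is the Parikh vector. Hence equivalent factors have the same data
(p, Ψ(u), q) or are equal as words. Equal words at different offsets modulo 2^k occur only at
offsets differing by 2^(k-1), with covering factors in y that are powers of opposite letters
(`mod_eq_or_constant_of_eq`).

Counting: summed over the 2^k offsets, the numbers of data give the terms in X, Y and the abelian
complexity. Each offset o for which a power of 1 covers at o and a power of 0 covers at the opposite
offset merges two data into one class (`binomComplexity_add_special`). The number of such o is the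
correction term (`card_filter_hasPower`).

For lengths below 2^k the moment argument gives literal equality, so only factors are counted. These
see at most two letters of y, and an aperiodic y has enough pairs to yield all those of t
(`factors_eq_factors_thueMorseWord`). -/

@[simp] theorem binom_nil_right (u : List A) : binom u [] = 1 := by
  induction u with
  | nil => simp [binom]
  | cons a u ih =>
    unfold binom at *
    rw [(List.sublists_cons_perm_append a u).count_eq, List.count_append, ih,
      List.count_eq_zero_of_not_mem (by simp)]

@[simp] theorem binom_nil_cons (b : A) (w : List A) : binom [] (b :: w) = 0 := by
  simp [binom]

theorem binom_cons_cons (a b : A) (u w : List A) :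
    binom (a :: u) (b :: w) = binom u (b :: w) + if a = b then binom u w else 0 := by
  unfold binom
  rw [(List.sublists_cons_perm_append a u).count_eq, List.count_append]
  congr 1
  split_ifs with h
  · subst h
    exact List.count_map_of_injective _ _ List.cons_injective _
  · exact List.count_eq_zero_of_not_mem (by simp [h])

theorem binom_singleton (u : List A) (a : A) : binom u [a] = u.count a := by
  induction u with
  | nil => simp
  | cons b u ih => rw [binom_cons_cons, ih, List.count_cons]; simp

theorem binom_append (u v w : List A) :
    binom (u ++ v) w =
      ∑ i ∈ Finset.range (w.length + 1), binom u (w.take i) * binom v (w.drop i) := by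
  induction u generalizing w with
  | nil =>
    rw [Finset.sum_eq_single 0]
    · simp
    · intro i hi h0
      cases w with
      | nil => simp at hi; omega
      | cons b w =>
        obtain ⟨i, rfl⟩ := Nat.exists_eq_succ_of_ne_zero h0
        simp
    · simp
  | cons a u ih =>
    cases w with
    | nil => simp
    | cons b w =>
      rw [List.cons_append, binom_cons_cons, ih, ih, List.length_cons, Finset.sum_range_succ',
        Finset.sum_range_succ' _ (w.length + 1)]
      simp only [List.take_succ_cons, List.drop_succ_cons, binom_cons_cons, List.take_zero,
        List.drop_zero, binom_nil_right, add_mul, Finset.sum_add_distrib]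
      split_ifs
      all_goals simp
      ring

/-- The relation `∼_k` underlying `binomSetoid`. -/
def BinomEquiv (k : ℕ) (u v : List A) : Prop :=
  ∀ w : List A, w.length ≤ k → binom u w = binom v w

theorem quotient_mk_eq_iff {k : ℕ} {u v : List A} :
    (Quotient.mk (binomSetoid A k) u = Quotient.mk (binomSetoid A k) v) ↔ BinomEquiv k u v :=
  ⟨fun h => Quotient.exact h, fun h => Quotient.sound h⟩

theorem BinomEquiv.refl (k : ℕ) (u : List A) : BinomEquiv k u u := fun _ _ => rfl

theorem BinomEquiv.trans {k : ℕ} {u v w : List A} (h₁ : BinomEquiv k u v)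
    (h₂ : BinomEquiv k v w) : BinomEquiv k u w := fun x hx => (h₁ x hx).trans (h₂ x hx)

theorem BinomEquiv.append {k : ℕ} {u v u' v' : List A} (h₁ : BinomEquiv k u u')
    (h₂ : BinomEquiv k v v') : BinomEquiv k (u ++ v) (u' ++ v') := by
  intro w hw
  rw [binom_append, binom_append]
  refine Finset.sum_congr rfl fun i _ => ?_
  rw [h₁ _ (by simp; omega), h₂ _ (by simp; omega)]

/-- Split each occurrence at the junction. A split with both parts nonempty uses subwords of length
at most k, where u and v agree; the two extreme splits contribute the counts of w in u and in v, a
symmetric sum. -/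
theorem BinomEquiv.append_comm {k : ℕ} {u v : List A} (h : BinomEquiv k u v) :
    BinomEquiv (k + 1) (u ++ v) (v ++ u) := by
  intro w hw
  cases w with
  | nil => simp
  | cons b w =>
    have split : ∀ f : ℕ → ℕ, ∑ i ∈ Finset.range (w.length + 1 + 1), f i =
        ∑ i ∈ Finset.range w.length, f (i + 1) + f 0 + f (w.length + 1) := fun f => by
      rw [Finset.sum_range_succ, Finset.sum_range_succ']
    have : ∀ i ∈ Finset.range w.length,
        binom u ((b :: w).take (i + 1)) * binom v ((b :: w).drop (i + 1)) =
          binom v ((b :: w).take (i + 1)) * binom u ((b :: w).drop (i + 1)) := by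
      intro i hi
      simp only [List.length_cons, Finset.mem_range] at hw hi
      rw [h ((b :: w).take (i + 1)) (by simp; omega),
        h ((b :: w).drop (i + 1)) (by simp; omega)]
    rw [binom_append, binom_append, List.length_cons, split, split, Finset.sum_congr rfl this]
    simp
    ring

theorem binomEquiv_one_iff {u v : List A} : BinomEquiv 1 u v ↔ u.Perm v := by
  rw [List.perm_iff_count]
  constructor
  · intro h a
    simpa [binom_singleton] using h [a] (by simp)
  · intro h w hw
    match w, hw with
    | [], _ => simp
    | [a], _ => simpa [binom_singleton] using h a

end Binom

/-! ### The Thue–Morse substitution on finite words -/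

/-- The Thue–Morse morphism on finite words. -/
def subst (u : List (Fin 2)) : List (Fin 2) := u.flatMap fun a => [a, 1 - a]

@[simp] theorem subst_nil : subst [] = [] := rfl

@[simp] theorem subst_cons (a : Fin 2) (u : List (Fin 2)) :
    subst (a :: u) = a :: (1 - a) :: subst u := rfl

@[simp] theorem subst_append (u v : List (Fin 2)) : subst (u ++ v) = subst u ++ subst v := by
  simp [subst]

@[simp] theorem length_subst (u : List (Fin 2)) : (subst u).length = 2 * u.length := by
  induction u with
  | nil => rfl
  | cons a u ih => simp [ih]; ring

theorem subst_iterate_append (k : ℕ) (u v : List (Fin 2)) :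
    subst^[k] (u ++ v) = subst^[k] u ++ subst^[k] v := by
  induction k generalizing u v with
  | zero => rfl
  | succ k ih => simp [ih]

@[simp] theorem length_subst_iterate (k : ℕ) (u : List (Fin 2)) :
    (subst^[k] u).length = 2 ^ k * u.length := by
  induction k with
  | zero => simp
  | succ k ih => rw [Function.iterate_succ_apply', length_subst, ih]; ring

/-- Since φ^(k+1)(a) = φ^k(a) φ^k(1-a), exchanging a and 1-a commutes two ∼_k-equivalent words,
which gains one order. -/
theorem subst_iterate_binomEquiv (k : ℕ) (a b : Fin 2) :
    BinomEquiv k (subst^[k] [a]) (subst^[k] [b]) := by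
  induction k generalizing a b with
  | zero => intro w hw; simp_all
  | succ k ih =>
    have key : ∀ a : Fin 2, BinomEquiv (k + 1) (subst^[k + 1] [a]) (subst^[k + 1] [1 - a]) := by
      intro a
      have h1 : ∀ a : Fin 2, subst^[k + 1] [a] = subst^[k] [a] ++ subst^[k] [1 - a] := by
        intro a
        rw [Function.iterate_succ_apply, ← subst_iterate_append]; rfl
      rw [h1, h1, sub_sub_cancel]
      exact (ih a (1 - a)).append_comm
    by_cases hab : a = b
    · subst hab; exact BinomEquiv.refl _ _
    · have : b = 1 - a := by revert a b; decide
      rw [this]; exact key a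

theorem subst_iterate_binomEquiv_of_perm {u v : List (Fin 2)} (h : u.Perm v) (k : ℕ) :
    BinomEquiv (k + 1) (subst^[k] u) (subst^[k] v) := by
  induction h with
  | nil => exact BinomEquiv.refl _ _
  | @cons a u v _ ih =>
    rw [← List.singleton_append, subst_iterate_append, ← List.singleton_append (l := v),
      subst_iterate_append]
    exact (BinomEquiv.refl _ _).append ih
  | swap a b l =>
    have e : ∀ a b : Fin 2, subst^[k] (a :: b :: l) =
        (subst^[k] [a] ++ subst^[k] [b]) ++ subst^[k] l := by
      intro a b
      rw [← subst_iterate_append, ← subst_iterate_append]; rfl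
    rw [e, e]
    exact (((subst_iterate_binomEquiv k b a).append_comm).append (BinomEquiv.refl _ _))
  | trans _ _ ih₁ ih₂ => exact ih₁.trans ih₂

/-! ### Signed moments of words -/

/-- The sign `+1` of the letter `0` and `-1` of the letter `1`. -/
def letterSign (a : Fin 2) : ℤ := if a = 0 then 1 else -1

theorem letterSign_one_sub (a : Fin 2) : letterSign (1 - a) = -letterSign a := by
  revert a; decide

theorem letterSign_injective : Function.Injective letterSign := by
  unfold Function.Injective; decide

theorem letterSign_eq (a : Fin 2) : letterSign a = 1 ∨ letterSign a = -1 := by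
  revert a; decide

/-- The sum over the letters of the word of their signs, weighted by a function of the number of
letters that follow. -/
def signedSum (g : ℕ → ℤ) : List (Fin 2) → ℤ
  | [] => 0
  | a :: u => letterSign a * g u.length + signedSum g u

@[simp] theorem signedSum_nil (g : ℕ → ℤ) : signedSum g [] = 0 := rfl

@[simp] theorem signedSum_cons (g : ℕ → ℤ) (a : Fin 2) (u : List (Fin 2)) :
    signedSum g (a :: u) = letterSign a * g u.length + signedSum g u := rfl

theorem signedSum_append (g : ℕ → ℤ) (u v : List (Fin 2)) :
    signedSum g (u ++ v) = signedSum (fun t => g (t + v.length)) u + signedSum g v := by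
  induction u with
  | nil => simp
  | cons a u ih => simp [ih, add_assoc]

/-- The two letters of φ(a) have opposite signs, so φ acts on weights as a difference operator. On
polynomials it lowers the degree by one. -/
theorem signedSum_subst (g : ℕ → ℤ) (u : List (Fin 2)) :
    signedSum g (subst u) = signedSum (fun t => g (2 * t + 1) - g (2 * t)) u := by
  induction u with
  | nil => simp
  | cons a u ih => simp [ih, letterSign_one_sub]; ring

theorem signedSum_add (g h : ℕ → ℤ) (u : List (Fin 2)) :
    signedSum (fun t => g t + h t) u = signedSum g u + signedSum h u := by
  induction u with
  | nil => simp
  | cons a u ih => simp [ih]; ring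

theorem signedSum_const_mul (c : ℤ) (g : ℕ → ℤ) (u : List (Fin 2)) :
    signedSum (fun t => c * g t) u = c * signedSum g u := by
  induction u with
  | nil => simp
  | cons a u ih => simp [ih]; ring

theorem signedSum_sum (n : ℕ) (g : ℕ → ℕ → ℤ) (u : List (Fin 2)) :
    signedSum (fun t => ∑ i ∈ Finset.range n, g i t) u =
      ∑ i ∈ Finset.range n, signedSum (g i) u := by
  induction u with
  | nil => simp
  | cons a u ih => simp [ih, Finset.mul_sum, Finset.sum_add_distrib]

/-- Two words have the same length and the same signed moments of all orders below `K`. -/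
def MomentEq (K : ℕ) (u v : List (Fin 2)) : Prop :=
  u.length = v.length ∧
    ∀ e < K, signedSum (fun t => (t : ℤ) ^ e) u = signedSum (fun t => (t : ℤ) ^ e) v

theorem MomentEq.mono {K L : ℕ} {u v : List (Fin 2)} (h : MomentEq L u v) (hKL : K ≤ L) :
    MomentEq K u v := ⟨h.1, fun e he => h.2 e (he.trans_le hKL)⟩

theorem MomentEq.symm {K : ℕ} {u v : List (Fin 2)} (h : MomentEq K u v) : MomentEq K v u :=
  ⟨h.1.symm, fun e he => (h.2 e he).symm⟩

/-! ### Binomial equivalence controls the moments -/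

/-- The sum of `h` over the binary words of length `i`. -/
def wordSum (h : List (Fin 2) → ℤ) : ℕ → ℤ
  | 0 => h []
  | i + 1 => wordSum (fun w => h (0 :: w)) i + wordSum (fun w => h (1 :: w)) i

theorem wordSum_congr {h h' : List (Fin 2) → ℤ} {i : ℕ} (H : ∀ w, w.length = i → h w = h' w) :
    wordSum h i = wordSum h' i := by
  induction i generalizing h h' with
  | zero => exact H [] rfl
  | succ i ih =>
    unfold wordSum
    rw [ih fun w hw => H (0 :: w) (by simp [hw]), ih fun w hw => H (1 :: w) (by simp [hw])]

theorem wordSum_add (h h' : List (Fin 2) → ℤ) (i : ℕ) :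
    wordSum (fun w => h w + h' w) i = wordSum h i + wordSum h' i := by
  induction i generalizing h h' with
  | zero => rfl
  | succ i ih => simp only [wordSum, ih]; ring

theorem wordSum_const_mul (c : ℤ) (h : List (Fin 2) → ℤ) (i : ℕ) :
    wordSum (fun w => c * h w) i = c * wordSum h i := by
  induction i generalizing h with
  | zero => rfl
  | succ i ih => simp only [wordSum, ih]; ring

theorem wordSum_zero (i : ℕ) : wordSum (fun _ => 0) i = 0 := by
  induction i with
  | zero => rfl
  | succ i ih => simp [wordSum, ih]

theorem wordSum_binom (u : List (Fin 2)) (i : ℕ) :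
    wordSum (fun w => (binom u w : ℤ)) i = (u.length.choose i : ℤ) := by
  induction u generalizing i with
  | nil => cases i with
    | zero => simp [wordSum]
    | succ i => simp [wordSum, wordSum_zero]
  | cons a u ih =>
    cases i with
    | zero => simp [wordSum]
    | succ i =>
      have h := ih (i + 1)
      simp only [wordSum] at h
      simp only [wordSum, binom_cons_cons, List.length_cons, Nat.choose_succ_succ, Nat.cast_add,
        wordSum_add, Nat.succ_eq_add_one]
      rw [← h, ← ih i]
      have ha : a = 0 ∨ a = 1 := by revert a; decide
      rcases ha with rfl | rfl <;> simp [wordSum_zero] <;> ring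

/-- A letter followed by t letters starts C(t, i) subwords of length i + 1. Summing over all
continuations turns binomial coefficients of words into signed moments in the basis C(t, i). -/
theorem wordSum_binom_sub (u : List (Fin 2)) (i : ℕ) :
    wordSum (fun w => (binom u (0 :: w) : ℤ) + (-1) * binom u (1 :: w)) i =
      signedSum (fun t => (t.choose i : ℤ)) u := by
  induction u with
  | nil => simp [wordSum_zero]
  | cons a u ih =>
    rw [signedSum_cons, ← ih, ← wordSum_binom, ← wordSum_const_mul, ← wordSum_add]
    refine wordSum_congr fun w _ => ?_
    have ha : a = 0 ∨ a = 1 := by revert a; decide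
    rcases ha with rfl | rfl <;> simp [binom_cons_cons, letterSign] <;> ring

theorem BinomEquiv.length_eq {k : ℕ} {u v : List (Fin 2)} (h : BinomEquiv (k + 1) u v) :
    u.length = v.length :=
  (binomEquiv_one_iff.1 fun w hw => h w (by omega)).length_eq

theorem BinomEquiv.momentEq {K : ℕ} {u v : List (Fin 2)} (hK : 1 ≤ K) (h : BinomEquiv K u v) :
    MomentEq K u v := by
  obtain ⟨K, rfl⟩ := Nat.exists_eq_add_of_le' hK
  refine ⟨h.length_eq, ?_⟩
  have key : ∀ e i, e + i < K + 1 →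
      signedSum (fun t => (t : ℤ) ^ e * (t.choose i : ℤ)) u =
        signedSum (fun t => (t : ℤ) ^ e * (t.choose i : ℤ)) v := by
    intro e
    induction e with
    | zero =>
      intro i hi
      simp only [pow_zero, one_mul, ← wordSum_binom_sub]
      refine wordSum_congr fun w hw => ?_
      rw [h (0 :: w) (by simp; omega), h (1 :: w) (by simp; omega)]
    | succ e ih =>
      intro i hi
      -- Change of basis from C(t, i) to powers: t C(t, i) = (i+1) C(t, i+1) + i C(t, i). Each
      -- factor t raises i by at most one, so e + i stays within the bound.
      have hid : (fun t : ℕ => (t : ℤ) ^ (e + 1) * (t.choose i : ℤ)) = fun t : ℕ =>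
          ((i + 1 : ℕ) : ℤ) * ((t : ℤ) ^ e * (t.choose (i + 1) : ℤ)) +
            (i : ℤ) * ((t : ℤ) ^ e * (t.choose i : ℤ)) := by
        funext t
        have h1 : (t.choose (i + 1) : ℤ) * ((i + 1 : ℕ) : ℤ) = t.choose i * ((t : ℤ) - i) := by
          rcases le_or_gt i t with hit | hit
          · have := Nat.choose_succ_right_eq t i
            rw [← Nat.cast_sub hit]
            exact_mod_cast this
          · rw [Nat.choose_eq_zero_of_lt hit, Nat.choose_eq_zero_of_lt (by omega)]; simp
        linear_combination (-(t : ℤ) ^ e) * h1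
      rw [hid, signedSum_add, signedSum_const_mul, signedSum_const_mul, signedSum_add,
        signedSum_const_mul, signedSum_const_mul, ih _ (by omega), ih _ (by omega)]
  intro e he
  simpa using key e 0 (by omega)

/-! ### Removing letters and desubstitution -/

theorem MomentEq.of_cons {K : ℕ} {c : Fin 2} {u v : List (Fin 2)}
    (h : MomentEq K (c :: u) (c :: v)) : MomentEq K u v := by
  have hl : u.length = v.length := by simpa using h.1
  refine ⟨hl, fun e he => ?_⟩
  simpa [hl] using h.2 e he

/-- Deleting the last letter translates t by one. The change of moments is triangular with unit
diagonal, hence invertible order by order. -/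
theorem MomentEq.of_append_singleton {K : ℕ} {d : Fin 2} {u v : List (Fin 2)}
    (h : MomentEq K (u ++ [d]) (v ++ [d])) : MomentEq K u v := by
  refine ⟨by simpa using h.1, fun e => ?_⟩
  induction e using Nat.strong_induction_on with
  | _ e ih =>
    intro he
    have h1 := h.2 e he
    simp only [signedSum_append, add_left_inj, List.length_singleton, Nat.cast_add, Nat.cast_one,
      add_pow, one_pow, mul_one] at h1
    rw [signedSum_sum, signedSum_sum, Finset.sum_range_succ, Finset.sum_range_succ] at h1
    have h2 : ∀ i ∈ Finset.range e,
        signedSum (fun t => (t : ℤ) ^ i * (e.choose i : ℤ)) u =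
          signedSum (fun t => (t : ℤ) ^ i * (e.choose i : ℤ)) v := by
      intro i hi
      rw [Finset.mem_range] at hi
      simp only [mul_comm _ ((e.choose i : ℕ) : ℤ), signedSum_const_mul]
      rw [ih i hi (hi.trans he)]
    rw [Finset.sum_congr rfl h2] at h1
    simpa using h1

/-- The moment of order e + 1 of φ(u) is a combination of the moments of u of order at most e, with
leading coefficient 2^e (e+1) ≠ 0. Lower orders cancel by induction. -/
theorem MomentEq.of_subst {K : ℕ} {u v : List (Fin 2)}
    (h : MomentEq (K + 1) (subst u) (subst v)) : MomentEq K u v := by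
  refine ⟨by simpa using h.1, fun e => ?_⟩
  induction e using Nat.strong_induction_on with
  | _ e ih =>
    intro he
    have h1 := h.2 (e + 1) (by omega)
    have hid : (fun t : ℕ => ((2 * t + 1 : ℕ) : ℤ) ^ (e + 1) - ((2 * t : ℕ) : ℤ) ^ (e + 1)) =
        fun t : ℕ => ∑ i ∈ Finset.range (e + 1), (2 ^ i * (e + 1).choose i : ℤ) * (t : ℤ) ^ i := by
      funext t
      push_cast
      rw [add_pow, Finset.sum_range_succ]
      simp only [one_pow, mul_one, Nat.choose_self, Nat.cast_one, add_sub_cancel_right, mul_pow]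
      exact Finset.sum_congr rfl fun i _ => by ring
    rw [signedSum_subst, signedSum_subst, hid, signedSum_sum, signedSum_sum,
      Finset.sum_range_succ, Finset.sum_range_succ] at h1
    have h2 : ∀ i ∈ Finset.range e,
        signedSum (fun t => (2 ^ i * (e + 1).choose i : ℤ) * (t : ℤ) ^ i) u =
          signedSum (fun t => (2 ^ i * (e + 1).choose i : ℤ) * (t : ℤ) ^ i) v := by
      intro i hi
      rw [Finset.mem_range] at hi
      rw [signedSum_const_mul, signedSum_const_mul, ih i hi (hi.trans he)]
    rw [Finset.sum_congr rfl h2, signedSum_const_mul, signedSum_const_mul] at h1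
    refine mul_left_cancel₀ ?_ (add_left_cancel h1)
    have : (e + 1).choose e ≠ 0 := (Nat.choose_pos (by omega)).ne'
    positivity

/-! ### Moments of order zero and one -/

theorem letterSign_mul_signedSum_one_le (c : Fin 2) (u : List (Fin 2)) :
    letterSign c * signedSum (fun _ => 1) u ≤ u.length := by
  induction u with
  | nil => simp
  | cons a u ih =>
    simp only [signedSum_cons, List.length_cons]
    push_cast
    rcases letterSign_eq a with ha | ha <;> rcases letterSign_eq c with hc | hc <;>
      rw [hc] at ih ⊢ <;> rw [ha] <;> linarith

theorem eq_replicate_of_signedSum_one {c : Fin 2} {u : List (Fin 2)}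
    (h : (u.length : ℤ) ≤ letterSign c * signedSum (fun _ => 1) u) :
    u = List.replicate u.length c := by
  induction u with
  | nil => simp
  | cons a u ih =>
    have h1 := letterSign_mul_signedSum_one_le c u
    simp only [signedSum_cons, List.length_cons] at h
    push_cast at h
    by_cases hac : a = c
    · subst hac
      rw [List.length_cons, List.replicate_succ, ← ih]
      rcases letterSign_eq a with ha | ha <;> rw [ha] at h ⊢ <;> linarith
    · exfalso
      have neg : ∀ a c : Fin 2, a ≠ c → letterSign a = -letterSign c := by decide
      rw [neg a c hac] at h
      rcases letterSign_eq c with hc | hc <;> rw [hc] at h h1 <;> linarith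

theorem subst_replicate_succ (n : ℕ) (c : Fin 2) :
    subst (List.replicate (n + 1) c) = c :: (subst (List.replicate n (1 - c)) ++ [1 - c]) := by
  induction n with
  | zero => rfl
  | succ n ih =>
    rw [List.replicate_succ, subst_cons, ih, List.replicate_succ, subst_cons, sub_sub_cancel]
    rfl

theorem subst_replicate_append (n : ℕ) (c : Fin 2) :
    subst (List.replicate n c) ++ [c] = c :: subst (List.replicate n (1 - c)) := by
  induction n with
  | zero => rfl
  | succ n ih =>
    rw [List.replicate_succ, subst_cons, List.cons_append, List.cons_append, ih,
      List.replicate_succ, subst_cons, sub_sub_cancel]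

/-! ### Comparing two factors of images under the morphism -/

theorem MomentEq.sum_one {K : ℕ} {u v : List (Fin 2)} (h : MomentEq (K + 1) u v) :
    signedSum (fun _ => 1) u = signedSum (fun _ => 1) v := by
  simpa using h.2 0 (by omega)

theorem MomentEq.sum_id {K : ℕ} {u v : List (Fin 2)} (h : MomentEq (K + 2) u v) :
    signedSum (fun t => (t : ℤ)) u = signedSum (fun t => (t : ℤ)) v := by
  simpa using h.2 1 (by omega)

theorem signedSum_one_subst (u : List (Fin 2)) : signedSum (fun _ => 1) (subst u) = 0 := by
  rw [signedSum_subst]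
  induction u with
  | nil => rfl
  | cons a u ih => rw [signedSum_cons, ih]; simp

theorem signedSum_id_subst (u : List (Fin 2)) :
    signedSum (fun t => (t : ℤ)) (subst u) = signedSum (fun _ => 1) u := by
  rw [signedSum_subst]
  congr 1
  funext t
  push_cast
  ring

theorem signedSum_id_append_singleton (u : List (Fin 2)) (d : Fin 2) :
    signedSum (fun t => (t : ℤ)) (u ++ [d]) =
      signedSum (fun t => (t : ℤ)) u + signedSum (fun _ => 1) u := by
  simp [signedSum_append, signedSum_add]

theorem signedSum_one_append_singleton (u : List (Fin 2)) (d : Fin 2) :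
    signedSum (fun _ => 1) (u ++ [d]) = signedSum (fun _ => 1) u + letterSign d := by
  simp [signedSum_append]

/-- Order 0 gives d = 1 - c. Order 1 says that the signed letter sums of u and v differ by ±(|u| +
|v|), the extreme value, so u is a power of c and v a power of 1 - c; for these the two words
coincide. -/
theorem MomentEq.subst_eq_cons_append {c d : Fin 2} {u v : List (Fin 2)}
    (h : MomentEq 2 (subst u) (c :: (subst v ++ [d]))) : subst u = c :: (subst v ++ [d]) := by
  have hl : u.length = v.length + 1 := by
    have := h.1
    simp at this
    omega
  have h0 := h.sum_one
  have h1 := h.sum_id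
  simp only [signedSum_cons, signedSum_one_append_singleton, signedSum_id_append_singleton,
    signedSum_one_subst, signedSum_id_subst, List.length_append, length_subst,
    List.length_singleton] at h0 h1
  push_cast at h0 h1
  have hd : d = 1 - c := letterSign_injective (by rw [letterSign_one_sub]; linarith)
  have hu := letterSign_mul_signedSum_one_le c u
  have hv := letterSign_mul_signedSum_one_le (1 - c) v
  have hlz : (u.length : ℤ) = v.length + 1 := by exact_mod_cast hl
  rw [letterSign_one_sub] at hv
  have hu' : u = List.replicate u.length c := by
    apply eq_replicate_of_signedSum_one
    rcases letterSign_eq c with hc | hc <;> rw [hc] at hu hv h1 ⊢ <;> linarith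
  have hv' : v = List.replicate v.length (1 - c) := by
    apply eq_replicate_of_signedSum_one
    rw [letterSign_one_sub]
    rcases letterSign_eq c with hc | hc <;> rw [hc] at hu hv h1 ⊢ <;> linarith
  rw [hu', hv', hl, hd, subst_replicate_succ]

theorem MomentEq.subst_append_eq_cons {c d : Fin 2} {u v : List (Fin 2)}
    (h : MomentEq 2 (subst u ++ [d]) (c :: subst v)) : subst u ++ [d] = c :: subst v := by
  have hl : u.length = v.length := by
    have := h.1
    simp at this
    omega
  have h0 := h.sum_one
  have h1 := h.sum_id
  simp only [signedSum_cons, signedSum_one_append_singleton, signedSum_id_append_singleton,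
    signedSum_one_subst, signedSum_id_subst, length_subst] at h0 h1
  push_cast at h0 h1
  have hd : d = c := letterSign_injective (by linarith)
  have hu := letterSign_mul_signedSum_one_le c u
  have hv := letterSign_mul_signedSum_one_le (1 - c) v
  have hlz : (u.length : ℤ) = v.length := by exact_mod_cast hl
  rw [letterSign_one_sub] at hv
  have hu' : u = List.replicate u.length c := by
    apply eq_replicate_of_signedSum_one
    rcases letterSign_eq c with hc | hc <;> rw [hc] at hu hv h1 ⊢ <;> linarith
  have hv' : v = List.replicate v.length (1 - c) := by
    apply eq_replicate_of_signedSum_one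
    rw [letterSign_one_sub]
    rcases letterSign_eq c with hc | hc <;> rw [hc] at hu hv h1 ⊢ <;> linarith
  rw [hu', hv', hl, hd, subst_replicate_append]

/-- By length parity D and D' are both empty or both single letters. If both are empty, order 0
reads off the head. Otherwise distinct heads would make the first moments differ by 4|u| + 2 before
the inner words contribute, and these can compensate at most 2|u|. -/
theorem MomentEq.head_eq {K : ℕ} {c d : Fin 2} {u v D D' : List (Fin 2)} (hD : D.length ≤ 1)
    (hD' : D'.length ≤ 1) (h : MomentEq (K + 2) (c :: (subst u ++ D)) (d :: (subst v ++ D'))) :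
    c = d := by
  have hl := h.1
  simp only [List.length_cons, List.length_append, length_subst] at hl
  by_contra hcd
  have h1 := h.sum_id
  have h0 := h.sum_one
  have hneg : ∀ a c : Fin 2, a ≠ c → letterSign a = -letterSign c := by decide
  have hu := letterSign_mul_signedSum_one_le c u
  have hu' := letterSign_mul_signedSum_one_le (1 - c) u
  have hv := letterSign_mul_signedSum_one_le c v
  have hv' := letterSign_mul_signedSum_one_le (1 - c) v
  rw [letterSign_one_sub] at hu' hv'
  rw [signedSum_cons, signedSum_cons, hneg d c (Ne.symm hcd)] at h0 h1
  match D, D', hD, hD' with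
  | [], [], _, _ =>
    simp only [List.append_nil, signedSum_one_subst] at h0
    rcases letterSign_eq c with hc | hc <;> rw [hc] at h0 <;> omega
  | [x], [z], _, _ =>
    simp only [signedSum_id_append_singleton, signedSum_id_subst, signedSum_one_subst,
      List.length_append, length_subst, List.length_singleton] at h1 hl
    have hlz : (u.length : ℤ) = v.length := by omega
    push_cast at h1
    rcases letterSign_eq c with hc | hc <;> rw [hc] at h1 hu hv hu' hv' <;> linarith
  | [], [z], _, _ => simp at hl; omega
  | [x], [], _, _ => simp at hl; omega

theorem MomentEq.of_subst_append {K : ℕ} {u v D D' : List (Fin 2)} (hD : D.length ≤ 1)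
    (hD' : D'.length ≤ 1) (h : MomentEq (K + 2) (subst u ++ D) (subst v ++ D')) :
    D = D' ∧ MomentEq (K + 1) u v := by
  have hl := h.1
  simp only [List.length_append, length_subst] at hl
  match D, D', hD, hD' with
  | [], [], _, _ => simp only [List.append_nil] at h; exact ⟨rfl, h.of_subst⟩
  | [x], [z], _, _ =>
    have h0 := h.sum_one
    simp only [signedSum_one_append_singleton, signedSum_one_subst, zero_add] at h0
    obtain rfl := letterSign_injective h0
    exact ⟨rfl, h.of_append_singleton.of_subst⟩
  | [], [z], _, _ => simp at hl; omega
  | [x], [], _, _ => simp at hl; omega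

/-- One level of desubstitution: words aligned on the same parity of cut lose their boundary letters
and one moment, while words cut at different parities must already be equal. -/
theorem MomentEq.eq_or_of_append_subst_append {K : ℕ} {P P' u v D D' : List (Fin 2)}
    (hP : P.length ≤ 1) (hP' : P'.length ≤ 1) (hD : D.length ≤ 1) (hD' : D'.length ≤ 1)
    (h : MomentEq (K + 2) (P ++ (subst u ++ D)) (P' ++ (subst v ++ D'))) :
    P ++ (subst u ++ D) = P' ++ (subst v ++ D') ∨ (P = P' ∧ D = D' ∧ MomentEq (K + 1) u v) := by
  have mixed : ∀ {c : Fin 2} {u v D D' : List (Fin 2)}, D.length ≤ 1 → D'.length ≤ 1 →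
      MomentEq (K + 2) (subst u ++ D) ([c] ++ (subst v ++ D')) →
      subst u ++ D = [c] ++ (subst v ++ D') := by
    intro c u v D D' hD hD' h
    have hl := h.1
    simp only [List.length_append, length_subst, List.length_singleton] at hl
    have h := h.mono (Nat.le_add_left 2 K)
    match D, D', hD, hD' with
    | [], [z], _, _ =>
      rw [List.append_nil] at h ⊢
      exact h.subst_eq_cons_append
    | [x], [], _, _ =>
      rw [List.append_nil] at h ⊢
      exact h.subst_append_eq_cons
    | [], [], _, _ => simp at hl; omega
    | [x], [z], _, _ => simp at hl; omega
  match P, P', hP, hP' with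
  | [], [], _, _ => exact Or.inr ⟨rfl, MomentEq.of_subst_append hD hD' h⟩
  | [c], [d], _, _ =>
    obtain rfl := MomentEq.head_eq hD hD' h
    exact Or.inr ⟨rfl, MomentEq.of_subst_append hD hD' h.of_cons⟩
  | [], [c], _, _ => exact Or.inl (mixed hD hD' h)
  | [c], [], _, _ => exact Or.inl (mixed hD' hD h.symm).symm

/-! ### Suffixes, prefixes and infixes of images -/

theorem exists_of_suffix_subst {p w : List (Fin 2)} (h : p <:+ subst w) :
    ∃ P q, P.length ≤ 1 ∧ q <:+ w ∧ p = P ++ subst q := by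
  induction w with
  | nil => exact ⟨[], [], by simp, List.suffix_rfl, by simpa using h⟩
  | cons a w ih =>
    rw [subst_cons, List.suffix_cons_iff, List.suffix_cons_iff] at h
    rcases h with rfl | rfl | h
    · exact ⟨[], a :: w, by simp, List.suffix_rfl, rfl⟩
    · exact ⟨[1 - a], w, by simp, List.suffix_cons a w, rfl⟩
    · obtain ⟨P, q, hP, hq, rfl⟩ := ih h
      exact ⟨P, q, hP, hq.trans (List.suffix_cons a w), rfl⟩

theorem exists_of_prefix_subst {s w : List (Fin 2)} (h : s <+: subst w) :
    ∃ q D, D.length ≤ 1 ∧ q <+: w ∧ s = subst q ++ D := by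
  induction w generalizing s with
  | nil => exact ⟨[], [], by simp, List.prefix_rfl, by simpa using h⟩
  | cons a w ih =>
    rw [subst_cons, List.prefix_cons_iff] at h
    rcases h with rfl | ⟨t, rfl, h⟩
    · exact ⟨[], [], by simp, List.nil_prefix, rfl⟩
    · rw [List.prefix_cons_iff] at h
      rcases h with rfl | ⟨t, rfl, h⟩
      · exact ⟨[], [a], by simp, List.nil_prefix, rfl⟩
      · obtain ⟨q, D, hD, hq, rfl⟩ := ih h
        exact ⟨a :: q, D, hD, by simpa using hq, rfl⟩

theorem exists_of_infix_subst {p w : List (Fin 2)} (h : p <:+: subst w) :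
    ∃ P q D, P.length ≤ 1 ∧ D.length ≤ 1 ∧ q <:+: w ∧ p = P ++ (subst q ++ D) := by
  obtain ⟨x, z, hxz⟩ := h
  obtain ⟨q, D, hD, hq, hs⟩ := exists_of_prefix_subst (s := x ++ p) ⟨z, hxz⟩
  have hp : p <:+ subst q ++ D := ⟨x, hs⟩
  match D, hD with
  | [], _ =>
    rw [List.append_nil] at hp
    obtain ⟨P, r, hP, hr, rfl⟩ := exists_of_suffix_subst hp
    exact ⟨P, r, [], hP, by simp, hr.isInfix.trans hq.isInfix, by simp⟩
  | [d], _ =>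
    rcases List.suffix_concat_iff.1 hp with rfl | ⟨t, rfl, ht⟩
    · exact ⟨[], [], [], by simp, by simp, List.nil_infix, rfl⟩
    · obtain ⟨P, r, hP, hr, rfl⟩ := exists_of_suffix_subst ht
      exact ⟨P, r, [d], hP, by simp, hr.isInfix.trans hq.isInfix, by simp⟩

/-- Each level halves the length, so a word shorter than 2^k is exhausted after k levels. -/
theorem MomentEq.eq_of_infix_of_length_lt {k : ℕ} {u v w w' : List (Fin 2)}
    (hu : u <:+: subst^[k] w) (hv : v <:+: subst^[k] w') (hlt : u.length < 2 ^ k)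
    (h : MomentEq (k + 1) u v) : u = v := by
  induction k generalizing u v with
  | zero =>
    have h1 : u = [] := List.length_eq_zero_iff.1 (by simpa using hlt)
    have h2 : v = [] := List.length_eq_zero_iff.1 (by rw [← h.1, h1]; rfl)
    rw [h1, h2]
  | succ k ih =>
    rw [Function.iterate_succ_apply'] at hu hv
    obtain ⟨P, q, D, hP, hD, hq, rfl⟩ := exists_of_infix_subst hu
    obtain ⟨P', q', D', hP', hD', hq', rfl⟩ := exists_of_infix_subst hv
    rcases MomentEq.eq_or_of_append_subst_append hP hP' hD hD' h with h | ⟨rfl, rfl, h'⟩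
    · exact h
    · rw [ih hq hq' (by simp [pow_succ] at hlt; omega) h']

theorem MomentEq.eq_or_of_suffix_of_prefix {k : ℕ} {p p' u u' s s' w w' z z' : List (Fin 2)}
    (hp : p <:+ subst^[k] w) (hp' : p' <:+ subst^[k] w') (hs : s <+: subst^[k] z)
    (hs' : s' <+: subst^[k] z') (lp : p.length < 2 ^ k) (lp' : p'.length < 2 ^ k)
    (ls : s.length < 2 ^ k) (ls' : s'.length < 2 ^ k)
    (h : MomentEq (k + 1) (p ++ (subst^[k] u ++ s)) (p' ++ (subst^[k] u' ++ s'))) :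
    p ++ (subst^[k] u ++ s) = p' ++ (subst^[k] u' ++ s') ∨
      (p = p' ∧ s = s' ∧ MomentEq 1 u u') := by
  induction k generalizing p p' s s' with
  | zero =>
    simp only [pow_zero, Nat.lt_one_iff, List.length_eq_zero_iff] at lp lp' ls ls'
    subst lp lp' ls ls'
    simp only [List.nil_append, List.append_nil] at h
    exact Or.inr ⟨rfl, rfl, h⟩
  | succ k ih =>
    rw [Function.iterate_succ_apply'] at hp hp' hs hs'
    obtain ⟨P, q, hP, hq, rfl⟩ := exists_of_suffix_subst hp
    obtain ⟨P', q', hP', hq', rfl⟩ := exists_of_suffix_subst hp'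
    obtain ⟨r, D, hD, hr, rfl⟩ := exists_of_prefix_subst hs
    obtain ⟨r', D', hD', hr', rfl⟩ := exists_of_prefix_subst hs'
    -- Isolates the outermost φ, leaving at most one stray letter at each end.
    have regroup : ∀ P q u r D : List (Fin 2),
        P ++ subst q ++ (subst^[k + 1] u ++ (subst r ++ D)) =
          P ++ (subst (q ++ (subst^[k] u ++ r)) ++ D) := by
      intro P q u r D
      rw [Function.iterate_succ_apply']
      simp
    rw [regroup, regroup] at h ⊢
    simp only [List.length_append, length_subst, pow_succ] at lp lp' ls ls'
    rcases MomentEq.eq_or_of_append_subst_append hP hP' hD hD' h with h | ⟨rfl, rfl, h'⟩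
    · exact Or.inl h
    · rcases ih hq hq' hr hr' (by omega) (by omega) (by omega) (by omega) h' with
        h | ⟨rfl, rfl, h''⟩
      · exact Or.inl (by rw [h])
      · exact Or.inr ⟨rfl, rfl, h''⟩

theorem momentEq_one_iff_parikh {u v : List (Fin 2)} : MomentEq 1 u v ↔ parikh u = parikh v := by
  have hl : ∀ u : List (Fin 2), (u.length : ℤ) = u.count 0 + u.count 1 := by
    intro u
    induction u with
    | nil => rfl
    | cons a u ih =>
      have ha : a = 0 ∨ a = 1 := by revert a; decide
      rcases ha with rfl | rfl <;> simp [ih] <;> ring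
  have hs : ∀ u : List (Fin 2), signedSum (fun _ => 1) u = u.count 0 - u.count 1 := by
    intro u
    induction u with
    | nil => rfl
    | cons a u ih =>
      have ha : a = 0 ∨ a = 1 := by revert a; decide
      rcases ha with rfl | rfl <;> simp [ih, letterSign] <;> ring
  constructor
  · intro h
    have h0 := h.sum_one
    have h1 : (u.length : ℤ) = v.length := by exact_mod_cast h.1
    rw [hs, hs] at h0
    rw [hl, hl] at h1
    funext a
    have ha : a = 0 ∨ a = 1 := by revert a; decide
    unfold parikh
    rcases ha with rfl | rfl <;> omega
  · intro h
    have h0 : u.count 0 = v.count 0 := congrFun h 0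
    have h1 : u.count 1 = v.count 1 := congrFun h 1
    refine ⟨by have := hl u; have := hl v; omega, fun e he => ?_⟩
    obtain rfl : e = 0 := by omega
    simp only [pow_zero]
    rw [hs, hs, h0, h1]

theorem perm_iff_parikh {u v : List (Fin 2)} : u.Perm v ↔ parikh u = parikh v := by
  rw [List.perm_iff_count, funext_iff]; rfl

/-! ### Factors and the morphism on infinite words -/

theorem factorAt_add {A : Type*} (x : ℕ → A) (i a b : ℕ) :
    factorAt x i (a + b) = factorAt x i a ++ factorAt x (i + a) b := by
  simp [factorAt, List.range_add, Function.comp_def, add_assoc]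

@[simp] theorem length_factorAt {A : Type*} (x : ℕ → A) (i n : ℕ) :
    (factorAt x i n).length = n := by
  simp [factorAt]

theorem factorAt_eq_iff {A : Type*} {x z : ℕ → A} {i j n : ℕ} :
    factorAt x i n = factorAt z j n ↔ ∀ t < n, x (i + t) = z (j + t) := by
  simp [factorAt]

@[simp] theorem factorAt_zero {A : Type*} (x : ℕ → A) (i : ℕ) : factorAt x i 0 = [] := rfl

@[simp] theorem factorAt_one {A : Type*} (x : ℕ → A) (i : ℕ) : factorAt x i 1 = [x i] := rfl

theorem factorAt_succ {A : Type*} (x : ℕ → A) (i n : ℕ) :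
    factorAt x i (n + 1) = x i :: factorAt x (i + 1) n := by
  rw [add_comm, factorAt_add]; rfl

theorem factorAt_thueMorseMorphism (z : ℕ → Fin 2) (s n : ℕ) :
    factorAt (thueMorseMorphism z) (2 * s) (2 * n) = subst (factorAt z s n) := by
  induction n generalizing s with
  | zero => rfl
  | succ n ih =>
    rw [mul_add_one, factorAt_succ, factorAt_succ, factorAt_succ, subst_cons, ← ih]
    congr 1
    · simp [thueMorseMorphism]
    · congr 1
      have : (2 * s + 1) / 2 = s := by omega
      simp [thueMorseMorphism, this]

theorem factorAt_iterate (k : ℕ) (y : ℕ → Fin 2) (s n : ℕ) :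
    factorAt (thueMorseMorphism^[k] y) (2 ^ k * s) (2 ^ k * n) = subst^[k] (factorAt y s n) := by
  induction k with
  | zero => simp
  | succ k ih =>
    rw [Function.iterate_succ_apply', Function.iterate_succ_apply', ← ih,
      ← factorAt_thueMorseMorphism]
    ring_nf

theorem thueMorseMorphism_eq_iff {z z' : ℕ → Fin 2} {n n' : ℕ} (h : n % 2 = n' % 2) :
    thueMorseMorphism z n = thueMorseMorphism z' n' ↔ z (n / 2) = z' (n' / 2) := by
  unfold thueMorseMorphism
  rw [h]
  split_ifs
  · rfl
  · exact sub_right_inj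

theorem thueMorseMorphism_eq_iff_of_ne {z z' : ℕ → Fin 2} {n n' : ℕ} (h : n % 2 ≠ n' % 2) :
    thueMorseMorphism z n = thueMorseMorphism z' n' ↔ z' (n' / 2) = 1 - z (n / 2) := by
  have key : ∀ a b : Fin 2, (a = 1 - b ↔ b = 1 - a) ∧ (1 - a = b ↔ b = 1 - a) := by decide
  unfold thueMorseMorphism
  split_ifs
  · omega
  · exact (key _ _).1
  · exact (key _ _).2
  · omega

theorem mod_two_pow_succ (n k : ℕ) : n % 2 ^ (k + 1) = n % 2 + 2 * (n / 2 % 2 ^ k) := by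
  rw [pow_succ', Nat.mod_mul]

theorem div_two_pow_succ (n k : ℕ) : n / 2 ^ (k + 1) = n / 2 / 2 ^ k := by
  rw [pow_succ', Nat.div_div_eq_div_mul]

theorem iterate_eq_iff {k : ℕ} {y y' : ℕ → Fin 2} {n n' : ℕ} (h : n % 2 ^ k = n' % 2 ^ k) :
    thueMorseMorphism^[k] y n = thueMorseMorphism^[k] y' n' ↔ y (n / 2 ^ k) = y' (n' / 2 ^ k) := by
  induction k generalizing n n' with
  | zero => simp
  | succ k ih =>
    rw [mod_two_pow_succ, mod_two_pow_succ] at h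
    rw [Function.iterate_succ_apply', Function.iterate_succ_apply',
      thueMorseMorphism_eq_iff (by omega), ih (by omega), div_two_pow_succ, div_two_pow_succ]

/-- The second half of φ^(k+1)(a) is the complement of the first half, so moving by 2^k inside the
periodic block pattern complements the letter. -/
theorem iterate_eq_iff_of_shift {k : ℕ} {y y' : ℕ → Fin 2} {n n' : ℕ}
    (h : (n + 2 ^ k) % 2 ^ (k + 1) = n' % 2 ^ (k + 1)) :
    thueMorseMorphism^[k + 1] y n = thueMorseMorphism^[k + 1] y' n' ↔
      y' (n' / 2 ^ (k + 1)) = 1 - y (n / 2 ^ (k + 1)) := by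
  induction k generalizing n n' with
  | zero =>
    simp only [zero_add, pow_one, pow_zero, Function.iterate_one] at h ⊢
    exact thueMorseMorphism_eq_iff_of_ne (by omega)
  | succ k ih =>
    rw [mod_two_pow_succ, mod_two_pow_succ n'] at h
    have h2 : (n + 2 ^ (k + 1)) / 2 = n / 2 + 2 ^ k := by rw [pow_succ]; omega
    have h3 : (n + 2 ^ (k + 1)) % 2 = n % 2 := by rw [pow_succ]; omega
    rw [h2, h3] at h
    rw [Function.iterate_succ_apply', Function.iterate_succ_apply' _ _ y',
      thueMorseMorphism_eq_iff (by omega), ih (by omega), div_two_pow_succ n,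
      div_two_pow_succ n']

/-! ### Literal coincidences of factors -/

theorem thueMorseMorphism_not_three (w : ℕ → Fin 2) (n : ℕ)
    (h₁ : thueMorseMorphism w n = thueMorseMorphism w (n + 1))
    (h₂ : thueMorseMorphism w (n + 1) = thueMorseMorphism w (n + 2)) : False := by
  have key : ∀ a : Fin 2, a ≠ 1 - a := by decide
  rw [thueMorseMorphism_eq_iff_of_ne (by omega)] at h₁ h₂
  rcases Nat.mod_two_eq_zero_or_one n with h | h
  · exact key _ ((show (n + 1) / 2 = n / 2 by omega) ▸ h₁)
  · exact key _ ((show (n + 2) / 2 = (n + 1) / 2 by omega) ▸ h₂)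

/-- The blocks of the two sides interlock: each step stays inside a block on exactly one side, and
the complement relation carries the value across to the other side. -/
theorem constant_of_mod_two_ne {z z' : ℕ → Fin 2} {i i' l : ℕ} (hi : i % 2 ≠ i' % 2)
    (h : ∀ t < l, thueMorseMorphism z (i + t) = thueMorseMorphism z' (i' + t)) :
    ∀ t < l, z ((i + t) / 2) = z (i / 2) ∧ z' ((i' + t) / 2) = 1 - z (i / 2) := by
  have key : ∀ a b : Fin 2, 1 - a = 1 - b → a = b := by decide
  have h' : ∀ t < l, z' ((i' + t) / 2) = 1 - z ((i + t) / 2) := fun t ht =>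
    (thueMorseMorphism_eq_iff_of_ne (by omega)).1 (h t ht)
  intro t
  induction t with
  | zero => exact fun ht => ⟨rfl, h' 0 ht⟩
  | succ t ih =>
    intro ht
    obtain ⟨h1, h2⟩ := ih (by omega)
    have h3 := h' (t + 1) ht
    rcases Nat.mod_two_eq_zero_or_one (i + t) with hp | hp
    · have e : (i + (t + 1)) / 2 = (i + t) / 2 := by omega
      rw [e, h1] at h3 ⊢
      exact ⟨rfl, h3⟩
    · have e : (i' + (t + 1)) / 2 = (i' + t) / 2 := by omega
      rw [e, h2] at h3 ⊢
      exact ⟨(key _ _ h3).symm, rfl⟩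

/-- Equal parities allow desubstitution on both sides. Different parities make the preimages
constant; this is possible only at the last level, because an image under φ contains no cube of a
letter. -/
theorem mod_eq_or_constant_of_eq {k : ℕ} {y y' : ℕ → Fin 2} {i i' l : ℕ} (hl : 2 ^ (k + 1) ≤ l)
    (h : ∀ t < l, thueMorseMorphism^[k + 1] y (i + t) = thueMorseMorphism^[k + 1] y' (i' + t)) :
    i % 2 ^ (k + 1) = i' % 2 ^ (k + 1) ∨
      ((i + 2 ^ k) % 2 ^ (k + 1) = i' % 2 ^ (k + 1) ∧ ∃ c, ∀ t < l,
        y ((i + t) / 2 ^ (k + 1)) = c ∧ y' ((i' + t) / 2 ^ (k + 1)) = 1 - c) := by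
  induction k generalizing i i' l with
  | zero =>
    simp only [zero_add, pow_one, pow_zero, Function.iterate_one] at h ⊢
    by_cases hi : i % 2 = i' % 2
    · exact Or.inl hi
    · exact Or.inr ⟨by omega, _, constant_of_mod_two_ne hi h⟩
  | succ k ih =>
    have hp : 1 ≤ 2 ^ k := Nat.one_le_two_pow
    by_cases hi : i % 2 = i' % 2
    -- This bound is the number of blocks of length 2 met by the window.
    · have h1 : ∀ t < (i + l - 1) / 2 - i / 2 + 1,
          thueMorseMorphism^[k + 1] y (i / 2 + t) = thueMorseMorphism^[k + 1] y' (i' / 2 + t) := by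
        intro t ht
        have h2 := h (2 * t - i % 2) (by omega)
        rw [Function.iterate_succ_apply', Function.iterate_succ_apply' _ _ y',
          thueMorseMorphism_eq_iff (by omega)] at h2
        have e : (i + (2 * t - i % 2)) / 2 = i / 2 + t := by omega
        have e' : (i' + (2 * t - i % 2)) / 2 = i' / 2 + t := by omega
        rwa [e, e'] at h2
      rw [mod_two_pow_succ i, mod_two_pow_succ i', mod_two_pow_succ (i + _)]
      have h2 : (i + 2 ^ (k + 1)) / 2 = i / 2 + 2 ^ k := by rw [pow_succ]; omega
      have h3 : (i + 2 ^ (k + 1)) % 2 = i % 2 := by rw [pow_succ]; omega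
      rw [h2, h3]
      rcases ih (by rw [pow_succ, pow_succ] at hl; rw [pow_succ]; omega) h1 with h4 | ⟨h4, c, h5⟩
      · left; omega
      · refine Or.inr ⟨by omega, c, fun t ht => ?_⟩
        have h6 := h5 ((i + t) / 2 - i / 2) (by omega)
        have e : i / 2 + ((i + t) / 2 - i / 2) = (i + t) / 2 := by omega
        have e' : i' / 2 + ((i + t) / 2 - i / 2) = (i' + t) / 2 := by omega
        rw [e, e'] at h6
        rwa [div_two_pow_succ, div_two_pow_succ (i' + t)]
    · exfalso
      -- A window of four letters starting at an odd position meets three blocks; the side with the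
      -- odd start gives the cube.
      have hl4 : 4 ≤ l := by rw [pow_succ, pow_succ] at hl; omega
      simp only [Function.iterate_succ_apply'] at h
      have hc := constant_of_mod_two_ne hi h
      rcases Nat.mod_two_eq_zero_or_one i with hi0 | hi1
      · refine thueMorseMorphism_not_three (thueMorseMorphism^[k] y') (i' / 2) ?_ ?_
        · rw [← show (i' + 0) / 2 = i' / 2 by omega, (hc 0 (by omega)).2,
            show (i' + 0) / 2 + 1 = (i' + 1) / 2 by omega, (hc 1 (by omega)).2]
        · rw [show i' / 2 + 1 = (i' + 1) / 2 by omega, (hc 1 (by omega)).2,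
            show i' / 2 + 2 = (i' + 3) / 2 by omega, (hc 3 (by omega)).2]
      · refine thueMorseMorphism_not_three (thueMorseMorphism^[k] y) (i / 2) ?_ ?_
        · rw [show i / 2 + 1 = (i + 1) / 2 by omega, (hc 1 (by omega)).1]
        · rw [show i / 2 + 1 = (i + 1) / 2 by omega, (hc 1 (by omega)).1,
            show i / 2 + 2 = (i + 3) / 2 by omega, (hc 3 (by omega)).1]

theorem subst_injective : Function.Injective subst := by
  intro u v h
  induction u generalizing v with
  | nil => cases v with
    | nil => rfl
    | cons b v => simp at h
  | cons a u ih => cases v with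
    | nil => simp at h
    | cons b v =>
      simp only [subst_cons, List.cons.injEq] at h
      rw [h.1, ih h.2.2]

/-! ### The data of a factor of `φ^k(y)` of length `2^k n + r`

The factor at the position `2^k s + o` with `o < 2^k` consists of a proper suffix of the image of
a block of at most one letter, the image of the inner block, and a proper prefix of the image of
a block of at most one letter. -/

/-- The length of the block that is cut by the left end. -/
def leftLen (o : ℕ) : ℕ := if o = 0 then 0 else 1

/-- The length of the block that is cut by the right end. -/
def rightLen (k r o : ℕ) : ℕ := if (o + r) % 2 ^ k = 0 then 0 else 1

/-- The length of the inner block. -/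
def innerLen (k n r o : ℕ) : ℕ := n + (o + r) / 2 ^ k - leftLen o

/-- The length of the factor of `y` whose image covers the given factor. -/
def coverLen (k n r o : ℕ) : ℕ := n + (o + r) / 2 ^ k + rightLen k r o

/-- The data that determine the `(k + 1)`-binomial class of the factor of length `2^k n + r` of
`φ^k(y)` at the position `2^k s + o`. -/
def windowData (y : ℕ → Fin 2) (k n r o s : ℕ) :
    List (Fin 2) × (Fin 2 → ℕ) × List (Fin 2) :=
  (factorAt y s (leftLen o), parikh (factorAt y (s + leftLen o) (innerLen k n r o)),
    factorAt y (s + leftLen o + innerLen k n r o) (rightLen k r o))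

/-- The factor of `y` that covers the factor of `φ^k(y)` is constant. -/
def ConstantCover (y : ℕ → Fin 2) (k n r : ℕ) (c : Fin 2) (o s : ℕ) : Prop :=
  ∀ t < coverLen k n r o, y (s + t) = c

theorem leftLen_le_one (o : ℕ) : leftLen o ≤ 1 := by unfold leftLen; split_ifs <;> omega

theorem leftLen_add_innerLen {k n r o : ℕ} (hn : 1 ≤ n) :
    leftLen o + innerLen k n r o = n + (o + r) / 2 ^ k := by
  have := leftLen_le_one o
  unfold innerLen
  generalize (o + r) / 2 ^ k = q
  omega

theorem le_two_pow_mul_leftLen {k o : ℕ} (ho : o < 2 ^ k) : o ≤ 2 ^ k * leftLen o := by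
  unfold leftLen
  split_ifs <;> simp <;> omega

theorem two_pow_mul_leftLen_sub_lt (k o : ℕ) : 2 ^ k * leftLen o - o < 2 ^ k := by
  have := Nat.two_pow_pos k
  unfold leftLen
  split_ifs
  all_goals simp
  omega

theorem mod_le_two_pow_mul_rightLen (k r o : ℕ) : (o + r) % 2 ^ k ≤ 2 ^ k * rightLen k r o := by
  have := Nat.mod_lt (o + r) (Nat.two_pow_pos k)
  unfold rightLen
  split_ifs <;> simp <;> omega

theorem window_length {k n r o : ℕ} (hn : 1 ≤ n) (ho : o < 2 ^ k) :
    2 ^ k * n + r = (2 ^ k * leftLen o - o) + (2 ^ k * innerLen k n r o + (o + r) % 2 ^ k) := by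
  have h1 := le_two_pow_mul_leftLen ho
  have h2 := Nat.div_add_mod (o + r) (2 ^ k)
  have h3 : 2 ^ k * leftLen o + 2 ^ k * innerLen k n r o = 2 ^ k * n + 2 ^ k * ((o + r) / 2 ^ k) := by
    rw [← mul_add, leftLen_add_innerLen hn, mul_add]
  omega

theorem factorAt_window {k n r o : ℕ} (hn : 1 ≤ n) (ho : o < 2 ^ k) (y : ℕ → Fin 2) (s : ℕ) :
    factorAt (thueMorseMorphism^[k] y) (2 ^ k * s + o) (2 ^ k * n + r) =
      factorAt (thueMorseMorphism^[k] y) (2 ^ k * s + o) (2 ^ k * leftLen o - o) ++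
        (subst^[k] (factorAt y (s + leftLen o) (innerLen k n r o)) ++
          factorAt (thueMorseMorphism^[k] y) (2 ^ k * (s + leftLen o + innerLen k n r o))
            ((o + r) % 2 ^ k)) := by
  have h1 := le_two_pow_mul_leftLen ho
  rw [window_length hn ho, factorAt_add, factorAt_add, ← factorAt_iterate]
  have e1 : 2 ^ k * s + o + (2 ^ k * leftLen o - o) = 2 ^ k * (s + leftLen o) := by
    rw [mul_add]; omega
  rw [e1, ← mul_add]

theorem left_part_suffix {k o : ℕ} (ho : o < 2 ^ k) (y : ℕ → Fin 2) (s : ℕ) :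
    factorAt (thueMorseMorphism^[k] y) (2 ^ k * s + o) (2 ^ k * leftLen o - o) <:+
      subst^[k] (factorAt y s (leftLen o)) := by
  have h1 := le_two_pow_mul_leftLen ho
  refine ⟨factorAt (thueMorseMorphism^[k] y) (2 ^ k * s) o, ?_⟩
  rw [← factorAt_add, ← factorAt_iterate]
  congr 1
  omega

theorem right_part_prefix (k : ℕ) (y : ℕ → Fin 2) (s e : ℕ) (he : e ≤ 2 ^ k) :
    factorAt (thueMorseMorphism^[k] y) (2 ^ k * s) e <+: subst^[k] (factorAt y s 1) := by
  refine ⟨factorAt (thueMorseMorphism^[k] y) (2 ^ k * s + e) (2 ^ k - e), ?_⟩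
  rw [← factorAt_add, ← factorAt_iterate]
  congr 1
  omega

theorem two_pow_mul_add_mod {k o : ℕ} (ho : o < 2 ^ k) (s : ℕ) : (2 ^ k * s + o) % 2 ^ k = o := by
  rw [Nat.mul_add_mod, Nat.mod_eq_of_lt ho]

theorem two_pow_mul_add_div (k o s : ℕ) : (2 ^ k * s + o) / 2 ^ k = s + o / 2 ^ k :=
  Nat.mul_add_div (Nat.two_pow_pos k) s o

theorem left_part_eq_iff {k o : ℕ} (ho : o < 2 ^ k) (y : ℕ → Fin 2) (s s' : ℕ) :
    factorAt (thueMorseMorphism^[k] y) (2 ^ k * s + o) (2 ^ k * leftLen o - o) =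
        factorAt (thueMorseMorphism^[k] y) (2 ^ k * s' + o) (2 ^ k * leftLen o - o) ↔
      factorAt y s (leftLen o) = factorAt y s' (leftLen o) := by
  rw [factorAt_eq_iff]
  by_cases h : o = 0
  · simp [leftLen, h]
  · simp only [leftLen, h, if_false, mul_one, factorAt_one, List.cons.injEq, and_true]
    have key : ∀ t < 2 ^ k - o,
        (thueMorseMorphism^[k] y (2 ^ k * s + o + t) = thueMorseMorphism^[k] y (2 ^ k * s' + o + t) ↔
          y s = y s') := by
      intro t ht
      rw [iterate_eq_iff (by simp only [add_assoc, Nat.mul_add_mod]), add_assoc, add_assoc,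
        two_pow_mul_add_div, two_pow_mul_add_div, Nat.div_eq_of_lt (by omega : o + t < 2 ^ k)]
      rfl
    exact ⟨fun H => (key 0 (by omega)).1 (H 0 (by omega)), fun H t ht => (key t ht).2 H⟩

theorem right_part_eq_iff (k r o : ℕ) (y : ℕ → Fin 2) (s s' : ℕ) :
    factorAt (thueMorseMorphism^[k] y) (2 ^ k * s) ((o + r) % 2 ^ k) =
        factorAt (thueMorseMorphism^[k] y) (2 ^ k * s') ((o + r) % 2 ^ k) ↔
      factorAt y s (rightLen k r o) = factorAt y s' (rightLen k r o) := by
  rw [factorAt_eq_iff]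
  have hlt := Nat.mod_lt (o + r) (Nat.two_pow_pos k)
  by_cases h : (o + r) % 2 ^ k = 0
  · simp [rightLen, h]
  · simp only [rightLen, h, if_false, factorAt_one, List.cons.injEq, and_true]
    have key : ∀ t < (o + r) % 2 ^ k,
        (thueMorseMorphism^[k] y (2 ^ k * s + t) = thueMorseMorphism^[k] y (2 ^ k * s' + t) ↔
          y s = y s') := by
      intro t ht
      rw [iterate_eq_iff (by simp only [Nat.mul_add_mod]),
        two_pow_mul_add_div, two_pow_mul_add_div, Nat.div_eq_of_lt (by omega : t < 2 ^ k)]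
      rfl
    exact ⟨fun H => (key 0 (by omega)).1 (H 0 (by omega)), fun H t ht => (key t ht).2 H⟩

theorem binomEquiv_of_windowData_eq {k n r o s s' : ℕ} (hn : 1 ≤ n) (ho : o < 2 ^ k)
    {y : ℕ → Fin 2} (h : windowData y k n r o s = windowData y k n r o s') :
    BinomEquiv (k + 1) (factorAt (thueMorseMorphism^[k] y) (2 ^ k * s + o) (2 ^ k * n + r))
      (factorAt (thueMorseMorphism^[k] y) (2 ^ k * s' + o) (2 ^ k * n + r)) := by
  simp only [windowData, Prod.mk.injEq] at h
  obtain ⟨h1, h2, h3⟩ := h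
  rw [factorAt_window hn ho, factorAt_window hn ho, (left_part_eq_iff ho y s s').2 h1,
    (right_part_eq_iff k r o y _ _).2 h3]
  exact (BinomEquiv.refl _ _).append
    ((subst_iterate_binomEquiv_of_perm (perm_iff_parikh.2 h2) k).append (BinomEquiv.refl _ _))

theorem window_lt_cover {k n r o t : ℕ} (ht : t < 2 ^ k * n + r) :
    (o + t) / 2 ^ k < coverLen k n r o := by
  apply Nat.div_lt_of_lt_mul
  have h2 := Nat.div_add_mod (o + r) (2 ^ k)
  have h3 := mod_le_two_pow_mul_rightLen k r o
  unfold coverLen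
  rw [mul_add, mul_add]
  omega

theorem exists_window_eq {k n r o h : ℕ} (hn : 1 ≤ n) (ho : o < 2 ^ k)
    (hh : h < coverLen k n r o) : ∃ t < 2 ^ k * n + r, (o + t) / 2 ^ k = h := by
  have hK := Nat.two_pow_pos k
  have hKn : 2 ^ k ≤ 2 ^ k * n := Nat.le_mul_of_pos_right _ hn
  have h2 := Nat.div_add_mod (o + r) (2 ^ k)
  -- The first position of the window in block h; for h = 0 the truncated difference is 0, the start
  -- of the window.
  refine ⟨2 ^ k * h - o, ?_, ?_⟩
  · rcases Nat.eq_zero_or_pos h with rfl | hpos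
    · simp; omega
    · have h4 : 2 ^ k * h < o + (2 ^ k * n + r) := by
        unfold coverLen rightLen at hh
        split_ifs at hh with h0
        · have : 2 ^ k * (h + 1) ≤ 2 ^ k * (n + (o + r) / 2 ^ k) := Nat.mul_le_mul_left _ hh
          rw [mul_add, mul_add] at this
          omega
        · have : 2 ^ k * h ≤ 2 ^ k * (n + (o + r) / 2 ^ k) := Nat.mul_le_mul_left _ (by omega)
          rw [mul_add] at this
          omega
      omega
  · rcases Nat.eq_zero_or_pos h with rfl | hpos
    · simp [Nat.div_eq_of_lt ho]
    · have : 2 ^ k ≤ 2 ^ k * h := Nat.le_mul_of_pos_right _ hpos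
      rw [show o + (2 ^ k * h - o) = 2 ^ k * h by omega, Nat.mul_div_cancel_left _ hK]

theorem factorAt_eq_of_constantCover {k n r o o' s s' : ℕ} {y : ℕ → Fin 2}
    (hoo : (o + 2 ^ k) % 2 ^ (k + 1) = o' % 2 ^ (k + 1))
    (h : ConstantCover y (k + 1) n r 0 o s) (h' : ConstantCover y (k + 1) n r 1 o' s') :
    factorAt (thueMorseMorphism^[k + 1] y) (2 ^ (k + 1) * s + o) (2 ^ (k + 1) * n + r) =
      factorAt (thueMorseMorphism^[k + 1] y) (2 ^ (k + 1) * s' + o') (2 ^ (k + 1) * n + r) := by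
  rw [factorAt_eq_iff]
  intro t ht
  rw [iterate_eq_iff_of_shift, add_assoc, add_assoc, two_pow_mul_add_div, two_pow_mul_add_div,
    h _ (window_lt_cover ht), h' _ (window_lt_cover ht), sub_zero]
  rw [add_assoc, add_assoc, add_assoc, Nat.mul_add_mod, Nat.mul_add_mod, ← add_assoc,
    add_right_comm, Nat.add_mod, hoo, ← Nat.add_mod]

/-- The converse of `binomEquiv_of_windowData_eq`, up to the only exception: literal equality of
factors at opposite offsets. -/
theorem windowData_eq_or_of_binomEquiv {k n r o o' s s' : ℕ} (hn : 1 ≤ n) (ho : o < 2 ^ (k + 1))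
    (ho' : o' < 2 ^ (k + 1)) {y : ℕ → Fin 2}
    (h : BinomEquiv (k + 1 + 1)
      (factorAt (thueMorseMorphism^[k + 1] y) (2 ^ (k + 1) * s + o) (2 ^ (k + 1) * n + r))
      (factorAt (thueMorseMorphism^[k + 1] y) (2 ^ (k + 1) * s' + o') (2 ^ (k + 1) * n + r))) :
    (o = o' ∧ windowData y (k + 1) n r o s = windowData y (k + 1) n r o' s') ∨
      ((o + 2 ^ k) % 2 ^ (k + 1) = o' ∧ ∃ c, ConstantCover y (k + 1) n r c o s ∧
        ConstantCover y (k + 1) n r (1 - c) o' s') := by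
  have hm := h.momentEq (by omega)
  rw [factorAt_window hn ho, factorAt_window hn ho'] at hm
  have hr : ∀ o, (o + r) % 2 ^ (k + 1) < 2 ^ (k + 1) := fun o => Nat.mod_lt _ (Nat.two_pow_pos _)
  rcases MomentEq.eq_or_of_suffix_of_prefix (left_part_suffix ho y s) (left_part_suffix ho' y s')
    (right_part_prefix _ y _ _ (hr o).le) (right_part_prefix _ y _ _ (hr o').le)
    (by simpa using two_pow_mul_leftLen_sub_lt _ o) (by simpa using two_pow_mul_leftLen_sub_lt _ o')
    (by simpa using hr o) (by simpa using hr o') hm with heq | ⟨h1, h2, h3⟩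
  · have heq' := heq
    rw [← factorAt_window hn ho, ← factorAt_window hn ho', factorAt_eq_iff] at heq
    have hl : 2 ^ (k + 1) ≤ 2 ^ (k + 1) * n + r :=
      (Nat.le_mul_of_pos_right _ hn).trans (Nat.le_add_right _ _)
    rcases mod_eq_or_constant_of_eq hl heq with hoo | ⟨hoo, c, hc⟩
    · rw [two_pow_mul_add_mod ho, two_pow_mul_add_mod ho'] at hoo
      subst hoo
      obtain ⟨e1, e2⟩ := List.append_inj heq' (by simp)
      obtain ⟨e2, e3⟩ := List.append_inj e2 (by simp)
      refine Or.inl ⟨rfl, ?_⟩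
      unfold windowData
      rw [(left_part_eq_iff ho y s s').1 e1, (right_part_eq_iff _ r o y _ _).1 e3,
        subst_injective.iterate _ e2]
    · rw [two_pow_mul_add_mod ho', add_assoc, Nat.mul_add_mod] at hoo
      refine Or.inr ⟨hoo, c, fun t ht => ?_, fun t ht => ?_⟩
      · obtain ⟨t', ht', rfl⟩ := exists_window_eq hn ho ht
        have := (hc t' ht').1
        rwa [add_assoc, two_pow_mul_add_div] at this
      · obtain ⟨t', ht', rfl⟩ := exists_window_eq hn ho' ht
        have := (hc t' ht').2
        rwa [add_assoc, two_pow_mul_add_div] at this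
  -- The length of the left part, 0 for o = 0 and 2^(k+1) - o otherwise, determines o.
  · have hoo : o = o' := by
      have := congrArg List.length h1
      simp only [length_factorAt] at this
      unfold leftLen at this
      split_ifs at this <;> omega
    subst hoo
    refine Or.inl ⟨rfl, ?_⟩
    unfold windowData
    rw [(left_part_eq_iff ho y s s').1 h1, (right_part_eq_iff _ r o y _ _).1 h2,
      momentEq_one_iff_parikh.1 h3]

/-! ### Counting -/

theorem ncard_image_eq_of_kernel_eq {α β γ : Type*} {S : Set α} {f : α → β} {g : α → γ}
    (h : ∀ a ∈ S, ∀ b ∈ S, f a = f b ↔ g a = g b) : (f '' S).ncard = (g '' S).ncard := by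
  refine Set.ncard_congr (fun _ hb => g hb.choose) (fun b hb => ⟨_, hb.choose_spec.1, rfl⟩) ?_ ?_
  · intro b c hb hc hbc
    rw [← hb.choose_spec.2, ← hc.choose_spec.2]
    exact (h _ hb.choose_spec.1 _ hc.choose_spec.1).2 hbc
  · rintro _ ⟨a, ha, rfl⟩
    have hb : f a ∈ f '' S := ⟨a, ha, rfl⟩
    exact ⟨f a, hb, (h _ hb.choose_spec.1 _ ha).1 hb.choose_spec.2⟩

theorem ncard_range_eq_of_kernel_eq {α β γ : Type*} {f : α → β} {g : α → γ}
    (h : ∀ a b, f a = f b ↔ g a = g b) : (Set.range f).ncard = (Set.range g).ncard := by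
  rw [← Set.image_univ, ← Set.image_univ]
  exact ncard_image_eq_of_kernel_eq fun a _ b _ => h a b

theorem finite_range_of_factorAt {β : Type*} [Nonempty β] {y : ℕ → Fin 2} (n : ℕ) {g : ℕ → β}
    (h : ∀ s s', factorAt y s n = factorAt y s' n → g s = g s') : (Set.range g).Finite := by
  obtain ⟨e, rfl⟩ := (Function.factorsThrough_iff (f := fun s => factorAt y s n) g).1
    fun s s' hs => h s s' hs
  rw [Set.range_comp]
  refine Set.Finite.image _ ((List.finite_length_eq (Fin 2) n).subset ?_)
  rintro _ ⟨s, rfl⟩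
  simp

theorem factorAt_cover {k n r o : ℕ} (hn : 1 ≤ n) (y : ℕ → Fin 2) (s : ℕ) :
    factorAt y s (coverLen k n r o) = factorAt y s (leftLen o) ++
      (factorAt y (s + leftLen o) (innerLen k n r o) ++
        factorAt y (s + leftLen o + innerLen k n r o) (rightLen k r o)) := by
  rw [← factorAt_add, ← factorAt_add, ← add_assoc, leftLen_add_innerLen hn]
  rfl

theorem finite_range_windowData {k n r o : ℕ} (hn : 1 ≤ n) (y : ℕ → Fin 2) :
    (Set.range (windowData y k n r o)).Finite := by
  refine finite_range_of_factorAt (y := y) (coverLen k n r o) fun s s' h => ?_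
  rw [factorAt_cover hn, factorAt_cover hn] at h
  obtain ⟨h1, h2⟩ := List.append_inj h (by simp)
  obtain ⟨h2, h3⟩ := List.append_inj h2 (by simp)
  unfold windowData
  rw [h1, h2, h3]

theorem constantCover_iff {k n r o s : ℕ} {y : ℕ → Fin 2} {c : Fin 2} :
    ConstantCover y k n r c o s ↔ ∀ a ∈ factorAt y s (coverLen k n r o), a = c := by
  simp [ConstantCover, factorAt]

theorem ConstantCover.of_windowData_eq {k n r o s s' : ℕ} (hn : 1 ≤ n) {y : ℕ → Fin 2} {c : Fin 2}
    (h : ConstantCover y k n r c o s) (hd : windowData y k n r o s = windowData y k n r o s') :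
    ConstantCover y k n r c o s' := by
  rw [constantCover_iff, factorAt_cover hn] at h ⊢
  simp only [windowData, Prod.mk.injEq] at hd
  intro a ha
  apply h a
  simpa only [List.mem_append, hd.1, hd.2.2, (perm_iff_parikh.2 hd.2.1).mem_iff] using ha

theorem ConstantCover.windowData_eq {k n r o s s' : ℕ} (hn : 1 ≤ n) {y : ℕ → Fin 2} {c : Fin 2}
    (h : ConstantCover y k n r c o s) (h' : ConstantCover y k n r c o s') :
    windowData y k n r o s = windowData y k n r o s' := by
  have e : factorAt y s (coverLen k n r o) = factorAt y s' (coverLen k n r o) := by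
    rw [factorAt_eq_iff]
    intro t ht
    rw [h t ht, h' t ht]
  rw [factorAt_cover hn, factorAt_cover hn] at e
  obtain ⟨h1, h2⟩ := List.append_inj e (by simp)
  obtain ⟨h2, h3⟩ := List.append_inj h2 (by simp)
  unfold windowData
  rw [h1, h2, h3]

theorem coverLen_pos {k n r o : ℕ} (hn : 1 ≤ n) : 0 < coverLen k n r o := by
  unfold coverLen
  generalize (o + r) / 2 ^ k = q
  omega

theorem ncard_image_windowData {k n r : ℕ} (hn : 1 ≤ n) (y : ℕ → Fin 2) (m : ℕ) :
    ((fun i : ℕ × ℕ => (i.1, windowData y k n r i.1 i.2)) '' {i | i.1 < m}).Finite ∧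
      ((fun i : ℕ × ℕ => (i.1, windowData y k n r i.1 i.2)) '' {i | i.1 < m}).ncard =
        ∑ o ∈ Finset.range m, (Set.range (windowData y k n r o)).ncard := by
  induction m with
  | zero => simp
  | succ m ih =>
    have hset : ((fun i : ℕ × ℕ => (i.1, windowData y k n r i.1 i.2)) '' {i | i.1 < m + 1}) =
        ((fun i : ℕ × ℕ => (i.1, windowData y k n r i.1 i.2)) '' {i | i.1 < m}) ∪
          Prod.mk m '' Set.range (windowData y k n r m) := by
      ext q
      constructor
      · rintro ⟨⟨o, s⟩, ho, rfl⟩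
        rcases Nat.lt_succ_iff_lt_or_eq.1 ho with ho | rfl
        · exact Or.inl ⟨(o, s), ho, rfl⟩
        · exact Or.inr ⟨_, ⟨s, rfl⟩, rfl⟩
      · rintro (⟨⟨o, s⟩, ho, rfl⟩ | ⟨_, ⟨s, rfl⟩, rfl⟩)
        · exact ⟨(o, s), Nat.lt_succ_of_lt ho, rfl⟩
        · exact ⟨(m, s), Nat.lt_succ_self m, rfl⟩
    have hfin := (finite_range_windowData hn y (k := k) (r := r) (o := m)).image (Prod.mk m)
    rw [hset]
    refine ⟨ih.1.union hfin, ?_⟩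
    rw [Set.ncard_union_eq _ ih.1 hfin, ih.2, Finset.sum_range_succ,
      Set.ncard_image_of_injective _ (Prod.mk_right_injective m)]
    rw [Set.disjoint_left]
    rintro _ ⟨⟨o, s⟩, ho, rfl⟩ ⟨_, _, h⟩
    simp only [Set.mem_ofPred_eq, Prod.mk.injEq] at ho h
    omega

/-- `c^n` is a factor of `y`. -/
def HasPower (y : ℕ → Fin 2) (c : Fin 2) (n : ℕ) : Prop := ∃ s, ∀ t < n, y (s + t) = c

theorem add_mod_two_mul {h o : ℕ} (ho : o < 2 * h) :
    (o + h) % (2 * h) = if o < h then o + h else o - h := by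
  split_ifs with hlt
  · exact Nat.mod_eq_of_lt (by omega)
  · rw [Nat.mod_eq_sub_mod (by omega), Nat.mod_eq_of_lt (by omega)]
    omega

open Classical in
-- After discarding `Z`, class and data have the same kernel, and no class is lost because each
-- discarded position has an equivalent partner covered by a power of 0. Stated as a sum to avoid
-- truncated subtraction.
theorem binomComplexity_add_special {k n r : ℕ} (hn : 1 ≤ n) (y : ℕ → Fin 2) :
    binomComplexity (k + 1 + 1) (thueMorseMorphism^[k + 1] y) (2 ^ (k + 1) * n + r) +
        ((Finset.range (2 ^ (k + 1))).filter fun o =>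
          HasPower y 1 (coverLen (k + 1) n r o) ∧
            HasPower y 0 (coverLen (k + 1) n r ((o + 2 ^ k) % 2 ^ (k + 1)))).card =
      ∑ o ∈ Finset.range (2 ^ (k + 1)), (Set.range (windowData y (k + 1) n r o)).ncard := by
  have hK := Nat.two_pow_pos (k + 1)
  set I : Set (ℕ × ℕ) := {i | i.1 < 2 ^ (k + 1)} with hI
  set D : ℕ × ℕ → ℕ × List (Fin 2) × (Fin 2 → ℕ) × List (Fin 2) :=
    fun i => (i.1, windowData y (k + 1) n r i.1 i.2) with hD
  set C : ℕ × ℕ → Quotient (binomSetoid (Fin 2) (k + 1 + 1)) := fun i =>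
    Quotient.mk _ (factorAt (thueMorseMorphism^[k + 1] y) (2 ^ (k + 1) * i.2 + i.1)
      (2 ^ (k + 1) * n + r)) with hC
  -- `Z` collects the positions whose cover is a power of `1` and whose class also contains
  -- a factor that is covered by a power of `0`.
  set Z : Set (ℕ × ℕ) := {i ∈ I | ConstantCover y (k + 1) n r 1 i.1 i.2 ∧
    ∃ s, ConstantCover y (k + 1) n r 0 ((i.1 + 2 ^ k) % 2 ^ (k + 1)) s} with hZ
  have hshift : ∀ o < 2 ^ (k + 1),
      ((o + 2 ^ k) % 2 ^ (k + 1) + 2 ^ k) % 2 ^ (k + 1) = o := by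
    intro o ho
    rw [pow_succ'] at ho ⊢
    rw [add_mod_two_mul ho]
    split_ifs with h <;> rw [add_mod_two_mul (by omega)] <;> split_ifs <;> omega
  have hDC : ∀ i ∈ I, ∀ j ∈ I, D i = D j → C i = C j := by
    rintro ⟨o, s⟩ hi ⟨o', s'⟩ - h
    simp only [hD, Prod.mk.injEq] at h
    obtain ⟨rfl, h⟩ := h
    exact quotient_mk_eq_iff.2 (binomEquiv_of_windowData_eq hn hi h)
  have hDZ : ∀ i ∈ Z, ∀ j ∈ I, D i = D j → j ∈ Z := by
    rintro ⟨o, s⟩ ⟨-, h1, h0⟩ ⟨o', s'⟩ hj h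
    simp only [hD, Prod.mk.injEq] at h
    obtain ⟨rfl, h⟩ := h
    exact ⟨hj, h1.of_windowData_eq hn h, h0⟩
  have hCS : C '' (I \ Z) = C '' I := by
    refine (Set.image_mono Set.sdiff_subset).antisymm ?_
    rintro _ ⟨⟨o, s⟩, hi, rfl⟩
    by_cases hz : (o, s) ∈ Z
    · obtain ⟨-, h1, s', h0⟩ := hz
      have ho' : (o + 2 ^ k) % 2 ^ (k + 1) < 2 ^ (k + 1) := Nat.mod_lt _ hK
      refine ⟨((o + 2 ^ k) % 2 ^ (k + 1), s'), ⟨ho', ?_⟩, ?_⟩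
      · rintro ⟨-, h1', -⟩
        have := h1' 0 (coverLen_pos hn)
        rw [h0 0 (coverLen_pos hn)] at this
        exact absurd this (by decide)
      · refine congrArg (Quotient.mk _) (factorAt_eq_of_constantCover ?_ h0 h1)
        change ((o + 2 ^ k) % 2 ^ (k + 1) + 2 ^ k) % 2 ^ (k + 1) = o % 2 ^ (k + 1)
        rw [hshift o hi, Nat.mod_eq_of_lt hi]
    · exact ⟨_, ⟨hi, hz⟩, rfl⟩
  have hker : ∀ i ∈ I \ Z, ∀ j ∈ I \ Z, C i = C j ↔ D i = D j := by
    rintro ⟨o, s⟩ ⟨hi, hiZ⟩ ⟨o', s'⟩ ⟨hj, hjZ⟩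
    refine ⟨fun h => ?_, hDC _ hi _ hj⟩
    have hi' : o < 2 ^ (k + 1) := hi
    have hj' : o' < 2 ^ (k + 1) := hj
    rcases windowData_eq_or_of_binomEquiv hn hi' hj' (quotient_mk_eq_iff.1 h) with
      ⟨rfl, h⟩ | ⟨ho, c, hc, hc'⟩
    · simp only [hD, h]
    · exfalso
      have ho' : (o' + 2 ^ k) % 2 ^ (k + 1) = o := by rw [← ho, hshift o hi']
      have h01 : ∀ c : Fin 2, c = 0 ∨ c = 1 := by decide
      rcases h01 c with rfl | rfl
      · exact hjZ ⟨hj, hc', s, by rw [ho']; exact hc⟩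
      · exact hiZ ⟨hi, hc, s', by rw [ho]; exact hc'⟩
  have hfac : (fun u => Quotient.mk (binomSetoid (Fin 2) (k + 1 + 1)) u) ''
      factors (thueMorseMorphism^[k + 1] y) (2 ^ (k + 1) * n + r) = C '' I := by
    ext q
    constructor
    · rintro ⟨_, ⟨i, rfl⟩, rfl⟩
      refine ⟨(i % 2 ^ (k + 1), i / 2 ^ (k + 1)), Nat.mod_lt _ hK, ?_⟩
      simp only [hC, Nat.div_add_mod]
    · rintro ⟨i, -, rfl⟩
      exact ⟨_, ⟨_, rfl⟩, rfl⟩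
  -- At a given offset a constant cover has only one datum, so the discarded data are counted by
  -- their offsets.
  have hZcard : (D '' Z).ncard = ((Finset.range (2 ^ (k + 1))).filter fun o =>
      HasPower y 1 (coverLen (k + 1) n r o) ∧
        HasPower y 0 (coverLen (k + 1) n r ((o + 2 ^ k) % 2 ^ (k + 1)))).card := by
    rw [ncard_image_eq_of_kernel_eq (g := Prod.fst), ← Set.ncard_coe_finset]
    · congr 1
      ext o
      simp only [Set.mem_image, Finset.coe_filter, Finset.mem_range, Set.mem_ofPred_eq]
      constructor
      · rintro ⟨⟨o, s⟩, ⟨ho, h1, h0⟩, rfl⟩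
        exact ⟨ho, ⟨s, h1⟩, h0⟩
      · rintro ⟨ho, ⟨s, h1⟩, h0⟩
        exact ⟨(o, s), ⟨ho, h1, h0⟩, rfl⟩
    · rintro ⟨o, s⟩ ⟨-, h1, -⟩ ⟨o', s'⟩ ⟨-, h1', -⟩
      refine ⟨fun h => (Prod.ext_iff.1 h).1, ?_⟩
      rintro (rfl : o = o')
      simp only [hD]
      rw [h1.windowData_eq hn h1']
  obtain ⟨hfin, hsum⟩ := ncard_image_windowData (k := k + 1) (r := r) hn y (2 ^ (k + 1))
  rw [← hsum, ← hZcard]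
  unfold binomComplexity
  rw [hfac, ← hCS, ncard_image_eq_of_kernel_eq hker,
    ← Set.ncard_union_eq ?_ (hfin.subset (Set.image_mono Set.sdiff_subset))
      (hfin.subset (Set.image_mono fun i hi => hi.1)), ← Set.image_union,
    Set.sdiff_union_of_subset (fun i hi => hi.1)]
  rw [Set.disjoint_left]
  rintro _ ⟨i, ⟨hi, hiZ⟩, rfl⟩ ⟨j, hj, hji⟩
  exact hiZ (hDZ j hj i hi hji)

/-! ### The cardinalities of the sets of data -/

theorem setX_succ_eq_range (y : ℕ → Fin 2) (m : ℕ) :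
    setX y (m + 1) =
      Set.range fun s => (y s, parikh (factorAt y (s + 1) m), y (s + 1 + m)) := by
  ext q
  constructor
  · rintro ⟨a, u, b, ⟨s, hs⟩, rfl⟩
    refine ⟨s, ?_⟩
    simp only [factorAt_succ y s, factorAt_add y _ m 1, factorAt_one, List.cons.injEq] at hs
    obtain ⟨rfl, hs⟩ := hs
    obtain ⟨rfl, hb⟩ := List.append_inj' hs rfl
    simp only [List.cons.injEq, and_true] at hb
    simp only [hb]
  · rintro ⟨s, rfl⟩
    exact ⟨_, _, _, ⟨s, by simp only [factorAt_succ y s, factorAt_add y _ m 1, factorAt_one]⟩, rfl⟩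

theorem setYL_eq_range (y : ℕ → Fin 2) (m : ℕ) :
    setYL y m = Set.range fun s => (y s, parikh (factorAt y (s + 1) m)) := by
  ext q
  constructor
  · rintro ⟨a, u, ⟨s, hs⟩, rfl⟩
    simp only [factorAt_succ y s, List.cons.injEq] at hs
    obtain ⟨rfl, rfl⟩ := hs
    exact ⟨s, rfl⟩
  · rintro ⟨s, rfl⟩
    exact ⟨_, _, ⟨s, factorAt_succ y s m⟩, rfl⟩

theorem setYR_eq_range (y : ℕ → Fin 2) (m : ℕ) :
    setYR y m = Set.range fun s => (parikh (factorAt y s m), y (s + m)) := by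
  ext q
  constructor
  · rintro ⟨u, a, ⟨s, hs⟩, rfl⟩
    refine ⟨s, ?_⟩
    simp only [factorAt_add y s m 1, factorAt_one] at hs
    obtain ⟨rfl, hb⟩ := List.append_inj' hs rfl
    simp only [List.cons.injEq, and_true] at hb
    simp only [hb]
  · rintro ⟨s, rfl⟩
    exact ⟨_, _, ⟨s, factorAt_add y s m 1⟩, rfl⟩

theorem ncard_setY (y : ℕ → Fin 2) (m : ℕ) :
    (setY y m).ncard = (setYL y m).ncard + (setYR y m).ncard := by
  have hL : (setYL y m).Finite := by
    rw [setYL_eq_range]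
    refine finite_range_of_factorAt (y := y) (m + 1) fun s s' h => ?_
    simp only [factorAt_succ, List.cons.injEq] at h
    rw [h.1, h.2]
  have hR : (setYR y m).Finite := by
    rw [setYR_eq_range]
    refine finite_range_of_factorAt (y := y) (m + 1) fun s s' h => ?_
    rw [factorAt_add, factorAt_add] at h
    obtain ⟨h1, h2⟩ := List.append_inj h (by simp)
    simp only [factorAt_one, List.cons.injEq, and_true] at h2
    rw [h1, h2]
  unfold setY
  rw [Set.ncard_union_eq _ (hL.image _) (hR.image _),
    Set.ncard_image_of_injective _ Sum.inl_injective,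
    Set.ncard_image_of_injective _ Sum.inr_injective]
  rw [Set.disjoint_left]
  rintro _ ⟨a, -, rfl⟩ ⟨b, -, h⟩
  simp at h

theorem ncard_range_windowData_inner {y : ℕ → Fin 2} {k n r o m : ℕ} (hl : leftLen o = 0)
    (hr : rightLen k r o = 0) (hm : innerLen k n r o = m) :
    (Set.range (windowData y k n r o)).ncard = binomComplexity 1 y m := by
  unfold binomComplexity factors
  rw [← Set.range_comp]
  refine ncard_range_eq_of_kernel_eq fun s s' => ?_
  simp [windowData, hl, hr, hm, quotient_mk_eq_iff, binomEquiv_one_iff, perm_iff_parikh]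

theorem ncard_range_windowData_both {y : ℕ → Fin 2} {k n r o m : ℕ} (hl : leftLen o = 1)
    (hr : rightLen k r o = 1) (hm : innerLen k n r o = m) :
    (Set.range (windowData y k n r o)).ncard = (setX y (m + 1)).ncard := by
  rw [setX_succ_eq_range]
  refine ncard_range_eq_of_kernel_eq fun s s' => ?_
  simp [windowData, hl, hr, hm]

theorem ncard_range_windowData_left {y : ℕ → Fin 2} {k n r o m : ℕ} (hl : leftLen o = 1)
    (hr : rightLen k r o = 0) (hm : innerLen k n r o = m) :
    (Set.range (windowData y k n r o)).ncard = (setYL y m).ncard := by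
  rw [setYL_eq_range]
  refine ncard_range_eq_of_kernel_eq fun s s' => ?_
  simp [windowData, hl, hr, hm]

theorem ncard_range_windowData_right {y : ℕ → Fin 2} {k n r o m : ℕ} (hl : leftLen o = 0)
    (hr : rightLen k r o = 1) (hm : innerLen k n r o = m) :
    (Set.range (windowData y k n r o)).ncard = (setYR y m).ncard := by
  rw [setYR_eq_range]
  refine ncard_range_eq_of_kernel_eq fun s s' => ?_
  simp [windowData, hl, hr, hm]

theorem sum_ncard_windowData_zero {n : ℕ} (k : ℕ) (hn : 1 ≤ n) (y : ℕ → Fin 2) :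
    ∑ o ∈ Finset.range (2 ^ k), (Set.range (windowData y k n 0 o)).ncard =
      (2 ^ k - 1) * (setX y n).ncard + binomComplexity 1 y n := by
  have hK := Nat.two_pow_pos k
  obtain ⟨n, rfl⟩ := Nat.exists_eq_add_of_le' hn
  rw [← Finset.sum_erase_add _ _ (Finset.mem_range.2 hK),
    ncard_range_windowData_inner (m := n + 1) (by simp [leftLen]) (by simp [rightLen])
      (by simp [innerLen, leftLen])]
  congr 1
  rw [Finset.sum_congr rfl (g := fun _ => (setX y (n + 1)).ncard)]
  · simp
  · intro o ho
    simp only [Finset.mem_erase, Finset.mem_range] at ho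
    apply ncard_range_windowData_both
    · simp [leftLen, ho.1]
    · simp [rightLen, Nat.mod_eq_of_lt ho.2, ho.1]
    · simp [innerLen, leftLen, Nat.div_eq_of_lt ho.2, ho.1]

theorem div_mod_two_pow {k r o : ℕ} (ho : o < 2 ^ k) (hr : r < 2 ^ k) :
    ((o + r) / 2 ^ k = 0 ∧ (o + r) % 2 ^ k = o + r ∧ o + r < 2 ^ k) ∨
      ((o + r) / 2 ^ k = 1 ∧ (o + r) % 2 ^ k = o + r - 2 ^ k ∧ 2 ^ k ≤ o + r) := by
  rcases lt_or_ge (o + r) (2 ^ k) with h | h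
  · exact Or.inl ⟨Nat.div_eq_of_lt h, Nat.mod_eq_of_lt h, h⟩
  · refine Or.inr ⟨?_, ?_, h⟩
    · rw [Nat.div_eq_sub_div (by omega) h, Nat.div_eq_of_lt (by omega)]
    · rw [Nat.mod_eq_sub_mod h, Nat.mod_eq_of_lt (by omega)]

theorem sum_ncard_windowData_pos {k n r : ℕ} (hn : 1 ≤ n) (hr0 : 0 < r) (hr : r < 2 ^ k)
    (y : ℕ → Fin 2) :
    ∑ o ∈ Finset.range (2 ^ k), (Set.range (windowData y k n r o)).ncard =
      (r - 1) * (setX y (n + 1)).ncard + (2 ^ k - r - 1) * (setX y n).ncard +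
        (setY y n).ncard := by
  obtain ⟨n, rfl⟩ := Nat.exists_eq_add_of_le' hn
  -- Offset 0 cuts only on the right; offset 2^k - r cuts only on the left. The 2^k - r - 1 offsets
  -- between them cut both ends around a short inner block, and the last r - 1 cut both ends around
  -- an inner block longer by one.
  have split : Finset.range (2 ^ k) =
      Finset.range (1 + ((2 ^ k - r - 1) + (1 + (r - 1)))) := by congr 1; omega
  rw [split, Finset.sum_range_add, Finset.sum_range_add, Finset.sum_range_add, ncard_setY,
    Finset.sum_range_one, Finset.sum_range_one]
  have hY : (Set.range (windowData y k (n + 1) r 0)).ncard = (setYR y (n + 1)).ncard := by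
    rcases div_mod_two_pow (Nat.two_pow_pos k) hr with ⟨h1, h2, h3⟩ | ⟨h1, h2, h3⟩
    · apply ncard_range_windowData_right
      · simp [leftLen]
      · simp only [rightLen, h2]; rw [if_neg (by omega)]
      · simp only [innerLen, leftLen, h1]; simp
    · omega
  have hY' : (Set.range (windowData y k (n + 1) r (1 + (2 ^ k - r - 1 + 0)))).ncard =
      (setYL y (n + 1)).ncard := by
    rcases div_mod_two_pow (show 1 + (2 ^ k - r - 1 + 0) < 2 ^ k by omega) hr with
      ⟨h1, h2, h3⟩ | ⟨h1, h2, h3⟩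
    · omega
    · apply ncard_range_windowData_left
      · simp [leftLen]
      · simp only [rightLen, h2]; rw [if_pos (by omega)]
      · simp only [innerLen, leftLen, h1]; rw [if_neg (by omega)]; omega
  have hX : ∀ o ∈ Finset.range (2 ^ k - r - 1),
      (Set.range (windowData y k (n + 1) r (1 + o))).ncard = (setX y (n + 1)).ncard := by
    intro o ho
    rw [Finset.mem_range] at ho
    rcases div_mod_two_pow (show 1 + o < 2 ^ k by omega) hr with ⟨h1, h2, h3⟩ | ⟨h1, h2, h3⟩
    · apply ncard_range_windowData_both
      · simp [leftLen]
      · simp only [rightLen, h2]; rw [if_neg (by omega)]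
      · simp only [innerLen, leftLen, h1]; rw [if_neg (by omega)]; omega
    · omega
  have hX' : ∀ o ∈ Finset.range (r - 1),
      (Set.range (windowData y k (n + 1) r (1 + (2 ^ k - r - 1 + (1 + o))))).ncard =
        (setX y (n + 1 + 1)).ncard := by
    intro o ho
    rw [Finset.mem_range] at ho
    rcases div_mod_two_pow (show 1 + (2 ^ k - r - 1 + (1 + o)) < 2 ^ k by omega) hr with
      ⟨h1, h2, h3⟩ | ⟨h1, h2, h3⟩
    · omega
    · apply ncard_range_windowData_both
      · simp [leftLen]
      · simp only [rightLen, h2]; rw [if_neg (by omega)]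
      · simp only [innerLen, leftLen, h1]; rw [if_neg (by omega)]; omega
  rw [hY, hY', Finset.sum_congr rfl hX, Finset.sum_congr rfl hX']
  simp only [Finset.sum_const, Finset.card_range, smul_eq_mul]
  ring

/-! ### Coincidences of covers by powers -/

theorem HasPower.mono {y : ℕ → Fin 2} {c : Fin 2} {m n : ℕ} (h : HasPower y c n) (hmn : m ≤ n) :
    HasPower y c m := by
  obtain ⟨s, hs⟩ := h
  exact ⟨s, fun t ht => hs t (by omega)⟩

theorem replicate_mem_factors_iff {y : ℕ → Fin 2} {c : Fin 2} {n : ℕ} :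
    List.replicate n c ∈ factors y n ↔ HasPower y c n := by
  unfold factors HasPower
  simp only [Set.mem_range, List.eq_replicate_iff, length_factorAt, true_and]
  simp [factorAt]

theorem lt_sSup_image_iff {S : Set ℕ} (hS : ∀ m n, m ≤ n → n ∈ S → m ∈ S) (n : ℕ) :
    (n : ℕ∞) < sSup ((fun n : ℕ => (n : ℕ∞)) '' S) ↔ n + 1 ∈ S := by
  rw [lt_sSup_iff]
  constructor
  · rintro ⟨_, ⟨m, hm, rfl⟩, hlt⟩
    exact hS _ _ (Nat.succ_le_of_lt (Nat.cast_lt.1 hlt)) hm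
  · intro h
    exact ⟨_, ⟨n + 1, h, rfl⟩, Nat.cast_lt.2 (Nat.lt_succ_self n)⟩

theorem lt_maxBothPowers_iff {y : ℕ → Fin 2} (n : ℕ) :
    (n : ℕ∞) < maxBothPowers y ↔ HasPower y 0 (n + 1) ∧ HasPower y 1 (n + 1) := by
  unfold maxBothPowers
  simp only [replicate_mem_factors_iff]
  rw [lt_sSup_image_iff]
  · rfl
  · exact fun m n hmn h => ⟨h.1.mono hmn, h.2.mono hmn⟩

theorem lt_maxSomePower_iff {y : ℕ → Fin 2} (n : ℕ) :
    (n : ℕ∞) < maxSomePower y ↔ HasPower y 0 (n + 1) ∨ HasPower y 1 (n + 1) := by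
  unfold maxSomePower
  simp only [replicate_mem_factors_iff]
  rw [lt_sSup_image_iff]
  · rfl
  · exact fun m n hmn h => h.imp (fun h => h.mono hmn) (fun h => h.mono hmn)

/-- For n ≥ 1, n ≤ m is the strict inequality n - 1 < m, so equality reduces to two strict
comparisons, also when m = ∞. -/
theorem eq_maxBothPowers_iff {y : ℕ → Fin 2} {n : ℕ} (hn : 1 ≤ n) :
    (n : ℕ∞) = maxBothPowers y ↔ (HasPower y 0 n ∧ HasPower y 1 n) ∧
      ¬(HasPower y 0 (n + 1) ∧ HasPower y 1 (n + 1)) := by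
  obtain ⟨n, rfl⟩ := Nat.exists_eq_add_of_le' hn
  rw [← lt_maxBothPowers_iff, ← lt_maxBothPowers_iff, not_lt, eq_comm, le_antisymm_iff, and_comm,
    Nat.cast_add, Nat.cast_one]
  refine and_congr_left fun _ => ?_
  exact ENat.add_one_le_iff (ENat.natCast_ne_top n)

theorem maxBothPowers_le (y : ℕ → Fin 2) : maxBothPowers y ≤ maxSomePower y := by
  apply sSup_le_sSup
  rintro _ ⟨n, hn, rfl⟩
  exact ⟨n, Or.inl hn.1, rfl⟩

theorem coverLen_zero {k n o : ℕ} (ho : o < 2 ^ k) :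
    coverLen k n 0 o = if o ≤ 0 then n else n + 1 := by
  simp only [coverLen, rightLen, add_zero, Nat.div_eq_of_lt ho, Nat.mod_eq_of_lt ho,
    Nat.le_zero]
  split_ifs <;> rfl

theorem coverLen_pos_eq {k n r o : ℕ} (ho : o < 2 ^ k) (hr0 : 0 < r) (hr : r < 2 ^ k) :
    coverLen k n r o = if o ≤ 2 ^ k - r then n + 1 else n + 1 + 1 := by
  simp only [coverLen, rightLen]
  rcases div_mod_two_pow ho hr with ⟨h1, h2, h3⟩ | ⟨h1, h2, h3⟩ <;> rw [h1, h2] <;>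
    split_ifs <;> omega

open Classical in
-- Covers have length N up to offset T and N + 1 beyond it. If both powers of exponent N + 1 occur,
-- every offset counts. If only one does, the offset of the other letter must be at most T. If
-- neither does, both opposite offsets must be at most T.
theorem card_filter_hasPower {h N T : ℕ} (hh : 0 < h) (hT : T < 2 * h) (hN : 1 ≤ N)
    (y : ℕ → Fin 2) :
    ((Finset.range (2 * h)).filter fun o => HasPower y 1 (if o ≤ T then N else N + 1) ∧
        HasPower y 0 (if (o + h) % (2 * h) ≤ T then N else N + 1)).card =
      if (N : ℕ∞) < maxBothPowers y then 2 * h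
      else if (N : ℕ∞) = maxBothPowers y ∧ maxBothPowers y < maxSomePower y then T + 1
      else if (N : ℕ∞) = maxBothPowers y ∧ maxBothPowers y = maxSomePower y then
        2 * (T + 1 - h) else 0 := by
  have m0 : HasPower y 0 (N + 1) → HasPower y 0 N := fun h => h.mono (by omega)
  have m1 : HasPower y 1 (N + 1) → HasPower y 1 N := fun h => h.mono (by omega)
  have hlt : (N : ℕ∞) = maxBothPowers y → (maxBothPowers y < maxSomePower y ↔
      HasPower y 0 (N + 1) ∨ HasPower y 1 (N + 1)) := by
    intro h
    rw [← h, lt_maxSomePower_iff]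
  have heq : maxBothPowers y = maxSomePower y ↔ ¬ maxBothPowers y < maxSomePower y :=
    ⟨fun h => h ▸ lt_irrefl _, fun h => (maxBothPowers_le y).antisymm (not_lt.1 h)⟩
  have hset : ∀ S : Finset ℕ, (∀ o, (o < 2 * h ∧ HasPower y 1 (if o ≤ T then N else N + 1) ∧
      HasPower y 0 (if (if o < h then o + h else o - h) ≤ T then N else N + 1)) ↔ o ∈ S) →
      ((Finset.range (2 * h)).filter fun o => HasPower y 1 (if o ≤ T then N else N + 1) ∧
        HasPower y 0 (if (o + h) % (2 * h) ≤ T then N else N + 1)).card = S.card := by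
    intro S hS
    congr 1
    ext o
    rw [← hS, Finset.mem_filter, Finset.mem_range]
    refine and_congr_right fun ho => ?_
    rw [add_mod_two_mul ho]
  simp only [heq, lt_maxBothPowers_iff]
  by_cases q : HasPower y 0 N ∧ HasPower y 1 N
  swap
  · have hne : ¬ (N : ℕ∞) = maxBothPowers y := fun h => q ((eq_maxBothPowers_iff hN).1 h).1
    rw [hset ∅, if_neg fun h => q ⟨m0 h.1, m1 h.2⟩, if_neg fun h => hne h.1,
      if_neg fun h => hne h.1, Finset.card_empty]
    intro o
    simp only [Finset.notMem_empty, iff_false]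
    rintro ⟨-, h1, h0⟩
    refine q ⟨?_, ?_⟩
    · split_ifs at h0 <;> first | exact h0 | exact m0 h0
    · split_ifs at h1 <;> first | exact h1 | exact m1 h1
  obtain ⟨q0, q1⟩ := q
  by_cases p0 : HasPower y 0 (N + 1) <;> by_cases p1 : HasPower y 1 (N + 1)
  · rw [hset (Finset.range (2 * h)), if_pos ⟨p0, p1⟩, Finset.card_range]
    intro o
    rw [Finset.mem_range]
    refine ⟨fun h => h.1, fun ho => ⟨ho, ?_, ?_⟩⟩
    · split_ifs <;> assumption
    · split_ifs <;> assumption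
  · have hne := (eq_maxBothPowers_iff hN).2 ⟨⟨q0, q1⟩, fun h => p1 h.2⟩
    have hl := (hlt hne).2 (Or.inl p0)
    rw [hset (Finset.range (T + 1)), if_neg fun h => p1 h.2, if_pos ⟨hne, hl⟩, Finset.card_range]
    intro o
    rw [Finset.mem_range]
    split_ifs <;> simp only [p0, p1, q0, q1, and_true, and_false, false_iff] <;> omega
  · have hne := (eq_maxBothPowers_iff hN).2 ⟨⟨q0, q1⟩, fun h => p0 h.1⟩
    have hl := (hlt hne).2 (Or.inr p1)
    -- Here the constraint falls on the shifted offset, so the set is the image of the initial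
    -- segment under the half-turn.
    rw [hset ((Finset.range (T + 1)).image fun o => if o < h then o + h else o - h),
      if_neg fun h => p0 h.1, if_pos ⟨hne, hl⟩, Finset.card_image_of_injOn, Finset.card_range]
    · intro a ha b hb hab
      simp only [Finset.coe_range, Set.mem_Iio] at ha hb
      dsimp only at hab
      split_ifs at hab <;> omega
    · intro o
      have e : o ∈ ((Finset.range (T + 1)).image fun o => if o < h then o + h else o - h) ↔
          o < 2 * h ∧ (if o < h then o + h else o - h) ≤ T := by
        simp only [Finset.mem_image, Finset.mem_range]
        constructor
        · rintro ⟨b, hb, rfl⟩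
          split_ifs <;> omega
        · rintro ⟨h1, h2⟩
          refine ⟨if o < h then o + h else o - h, by omega, ?_⟩
          split_ifs <;> omega
      rw [e]
      refine and_congr_right fun _ => ?_
      have h1 : HasPower y 1 (if o ≤ T then N else N + 1) := by split_ifs <;> assumption
      generalize (if o < h then o + h else o - h) = o'
      by_cases ho : o' ≤ T <;> simp [ho, p0, q0, h1]
  · have hne := (eq_maxBothPowers_iff hN).2 ⟨⟨q0, q1⟩, fun h => p0 h.1⟩
    have hl := fun h => ((hlt hne).1 h).elim p0 p1
    -- Both o and its half-turn are at most T: either o + h ≤ T, or h ≤ o ≤ T. The truncated T + 1 -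
    -- h makes both parts empty when T < h.
    rw [hset (Finset.range (T + 1 - h) ∪ Finset.Ico h (T + 1)), if_neg fun h => p0 h.1,
      if_neg fun h => hl h.2, if_pos ⟨hne, hl⟩, Finset.card_union_of_disjoint, Finset.card_range,
      Nat.card_Ico]
    · omega
    · rw [Finset.disjoint_left]
      intro o ho
      rw [Finset.mem_range] at ho
      rw [Finset.mem_Ico]
      omega
    · intro o
      rw [Finset.mem_union, Finset.mem_range, Finset.mem_Ico]
      split_ifs <;> simp only [p0, p1, q0, q1, and_true, and_false, false_iff] <;> omega

open Classical in
theorem card_filter_coverLen {k n r N T : ℕ} (hN : 1 ≤ N) (hT : T < 2 ^ (k + 1))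
    (h : ∀ o < 2 ^ (k + 1), coverLen (k + 1) n r o = if o ≤ T then N else N + 1)
    (y : ℕ → Fin 2) :
    ((Finset.range (2 ^ (k + 1))).filter fun o =>
      HasPower y 1 (coverLen (k + 1) n r o) ∧
        HasPower y 0 (coverLen (k + 1) n r ((o + 2 ^ k) % 2 ^ (k + 1)))).card =
      if (N : ℕ∞) < maxBothPowers y then 2 ^ (k + 1)
      else if (N : ℕ∞) = maxBothPowers y ∧ maxBothPowers y < maxSomePower y then T + 1
      else if (N : ℕ∞) = maxBothPowers y ∧ maxBothPowers y = maxSomePower y then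
        2 * (T + 1 - 2 ^ k) else 0 := by
  rw [pow_succ'] at hT h ⊢
  have hh := Nat.two_pow_pos k
  rw [← card_filter_hasPower hh hT hN y]
  congr 1
  refine Finset.filter_congr fun o ho => ?_
  rw [Finset.mem_range] at ho
  rw [h o ho, h _ (Nat.mod_lt _ (by omega))]

/-! ### Short factors -/

theorem Aperiodic.exists_ne {y : ℕ → Fin 2} (hy : Aperiodic y) (a : Fin 2) :
    ∃ s, y s = a ∧ y (s + 1) = 1 - a := by
  by_contra! h
  have key : ∀ a b : Fin 2, b ≠ 1 - a → b = a := by decide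
  have hstep : ∀ s, y s = a → y (s + 1) = a := fun s hs => key _ _ (h s hs)
  refine hy ?_
  by_cases hex : ∃ s, y s = a
  · obtain ⟨N, hN⟩ := hex
    have hc : ∀ n, N ≤ n → y n = a := fun n hn => Nat.le_induction hN (fun m _ => hstep m) n hn
    exact ⟨1, N, one_pos, fun n hn => by rw [hc n hn, hc (n + 1) (by omega)]⟩
  · have key' : ∀ a b c : Fin 2, b ≠ a → c ≠ a → b = c := by decide
    push Not at hex
    exact ⟨1, 0, one_pos, fun n _ => key' a _ _ (hex _) (hex _)⟩

theorem Aperiodic.exists_eq {y : ℕ → Fin 2} (hy : Aperiodic y) :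
    ∃ s, y (s + 1) = y s := by
  by_contra! h
  have key : ∀ a b c : Fin 2, b ≠ a → c ≠ b → c = a := by decide
  exact hy ⟨2, 0, two_pos, fun n _ => key _ _ _ (h n) (h (n + 1))⟩

theorem exists_thueMorseWord_pair (a b : Fin 2) :
    ∃ s, thueMorseWord s = a ∧ thueMorseWord (s + 1) = b := by
  have h0 : thueMorseWord 0 = 0 := by simp [thueMorseWord]
  have h1 : thueMorseWord 1 = 1 := by simp [thueMorseWord]
  have h2 : thueMorseWord 2 = 1 := by simp [thueMorseWord]
  have h3 : thueMorseWord 3 = 0 := by simp [thueMorseWord]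
  have h5 : thueMorseWord 5 = 0 := by simp [thueMorseWord]
  have h6 : thueMorseWord 6 = 0 := by simp [thueMorseWord]
  have hab : ∀ a : Fin 2, a = 0 ∨ a = 1 := by decide
  rcases hab a with rfl | rfl <;> rcases hab b with rfl | rfl
  · exact ⟨5, h5, h6⟩
  · exact ⟨0, h0, h1⟩
  · exact ⟨2, h2, h3⟩
  · exact ⟨1, h1, h2⟩

theorem factorAt_mem_factors_of_pair {k r o s s' : ℕ} {y z : ℕ → Fin 2} (ho : o < 2 ^ k)
    (hr : r < 2 ^ k) (h0 : y s = z s') (h1 : y (s + 1) = z (s' + 1)) :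
    factorAt (thueMorseMorphism^[k] y) (2 ^ k * s + o) r ∈
      factors (thueMorseMorphism^[k] z) r := by
  refine ⟨2 ^ k * s' + o, ?_⟩
  dsimp only
  rw [factorAt_eq_iff]
  intro t ht
  rw [iterate_eq_iff (by simp only [add_assoc, Nat.mul_add_mod]), add_assoc, add_assoc,
    two_pow_mul_add_div, two_pow_mul_add_div]
  have hlt : (o + t) / 2 ^ k < 2 := Nat.div_lt_of_lt_mul (by omega)
  generalize (o + t) / 2 ^ k = q at hlt
  interval_cases q
  · exact h0.symm
  · exact h1.symm

/-- With w the first half of φ^(k+1)(a) and w' its complement, the images of aa and of the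
complementary square are w w' w w' and w' w w' w. They have the same factors of length below
2^(k+1), half a block apart. -/
theorem factorAt_mem_factors_of_pair_complement {k r o s s' : ℕ} {y z : ℕ → Fin 2}
    (ho : o < 2 ^ (k + 1)) (hr : r < 2 ^ (k + 1)) (hy : y (s + 1) = y s)
    (h0 : z s' = 1 - y s) (h1 : z (s' + 1) = 1 - y s) :
    factorAt (thueMorseMorphism^[k + 1] y) (2 ^ (k + 1) * s + o) r ∈
      factors (thueMorseMorphism^[k + 1] z) r := by
  have hK : 2 ^ (k + 1) = 2 * 2 ^ k := pow_succ' 2 k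
  set o' := if o < 2 ^ k then o + 2 ^ k else o - 2 ^ k with ho'
  refine ⟨2 ^ (k + 1) * s' + o', ?_⟩
  dsimp only
  rw [eq_comm, factorAt_eq_iff]
  intro t ht
  rw [iterate_eq_iff_of_shift, add_assoc, add_assoc, two_pow_mul_add_div, two_pow_mul_add_div]
  · have hlt : (o + t) / 2 ^ (k + 1) < 2 := Nat.div_lt_of_lt_mul (by omega)
    have hlt' : (o' + t) / 2 ^ (k + 1) < 2 :=
      Nat.div_lt_of_lt_mul (by rw [ho']; split_ifs <;> omega)
    generalize (o + t) / 2 ^ (k + 1) = q at hlt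
    generalize (o' + t) / 2 ^ (k + 1) = q' at hlt'
    interval_cases q <;> interval_cases q' <;> simp [hy, h0, h1]
  · rw [add_assoc, add_assoc, add_assoc, Nat.mul_add_mod, Nat.mul_add_mod, ho']
    split_ifs
    · congr 1; omega
    · rw [show o + (t + 2 ^ k) = (o - 2 ^ k + t) + 2 ^ (k + 1) by omega, Nat.add_mod_right]

theorem iterate_thueMorseWord (k : ℕ) : thueMorseMorphism^[k] thueMorseWord = thueMorseWord :=
  Function.iterate_fixed thueMorseMorphism_thueMorseWord k

/-- An aperiodic word contains 01, 10 and at least one of 00, 11; the complement lemma supplies the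
missing square. -/
theorem factors_eq_factors_thueMorseWord {y : ℕ → Fin 2} (hy : Aperiodic y) {k r : ℕ}
    (hr : r < 2 ^ (k + 1)) :
    factors (thueMorseMorphism^[k + 1] y) r = factors thueMorseWord r := by
  have hK := Nat.two_pow_pos (k + 1)
  have key : ∀ a b : Fin 2, b ≠ a → b = 1 - a := by decide
  rw [← iterate_thueMorseWord (k + 1)]
  apply Set.Subset.antisymm
  · rintro _ ⟨i, rfl⟩
    obtain ⟨s, h0, h1⟩ :=
      exists_thueMorseWord_pair (y (i / 2 ^ (k + 1))) (y (i / 2 ^ (k + 1) + 1))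
    dsimp only
    rw [← Nat.div_add_mod i (2 ^ (k + 1))]
    exact factorAt_mem_factors_of_pair (Nat.mod_lt _ hK) hr h0.symm h1.symm
  · rintro _ ⟨i, rfl⟩
    dsimp only
    rw [← Nat.div_add_mod i (2 ^ (k + 1))]
    have ho := Nat.mod_lt i hK
    generalize i / 2 ^ (k + 1) = q at *
    generalize i % 2 ^ (k + 1) = o at *
    by_cases ht : thueMorseWord (q + 1) = thueMorseWord q
    · obtain ⟨s, hs⟩ := hy.exists_eq
      by_cases hs' : y s = thueMorseWord q
      · exact factorAt_mem_factors_of_pair ho hr hs'.symm (by rw [ht, hs, hs'])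
      · have := key _ _ hs'
        exact factorAt_mem_factors_of_pair_complement ho hr ht this (by rw [hs, this])
    · obtain ⟨s, h0, h1⟩ := hy.exists_ne (thueMorseWord q)
      exact factorAt_mem_factors_of_pair ho hr h0.symm (by rw [h1, key _ _ ht])

theorem factorAt_infix (k : ℕ) (y : ℕ → Fin 2) (i r : ℕ) :
    factorAt (thueMorseMorphism^[k] y) i r <:+: subst^[k] (factorAt y 0 (i + r)) := by
  have hle : i + r ≤ 2 ^ k * (i + r) := Nat.le_mul_of_pos_left _ (Nat.two_pow_pos k)
  rw [← factorAt_iterate, mul_zero]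
  obtain ⟨d, hd⟩ := Nat.exists_eq_add_of_le hle
  rw [hd, factorAt_add, factorAt_add, zero_add]
  exact ⟨_, _, rfl⟩

theorem binomComplexity_eq_factorComplexity_of_lt {k r : ℕ} (hr : r < 2 ^ k) (y : ℕ → Fin 2) :
    binomComplexity (k + 1) (thueMorseMorphism^[k] y) r =
      factorComplexity (thueMorseMorphism^[k] y) r := by
  unfold binomComplexity factorComplexity
  apply Set.InjOn.ncard_image
  rintro _ ⟨i, rfl⟩ _ ⟨j, rfl⟩ h
  exact MomentEq.eq_of_infix_of_length_lt (factorAt_infix k y i r) (factorAt_infix k y j r)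
    (by simpa using hr) ((quotient_mk_eq_iff.1 h).momentEq (by omega))

end BinomialWords

theorem mainTheorem9 (y : ℕ → Fin 2) (k : ℕ) (hk : 1 ≤ k) :
    (Aperiodic y → ∀ r : ℕ, r < 2 ^ k →
      binomComplexity (k + 1) (thueMorseMorphism^[k] y) r = factorComplexity thueMorseWord r) ∧
    (∀ n : ℕ, 1 ≤ n →
      (binomComplexity (k + 1) (thueMorseMorphism^[k] y) (2 ^ k * n) : ℤ) =
        ((2 : ℤ) ^ k - 1) * ((setX y n).ncard : ℤ) + (binomComplexity 1 y n : ℤ) -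
          (if (n : ℕ∞) < maxBothPowers y then (2 : ℤ) ^ k
            else if (n : ℕ∞) = maxBothPowers y ∧ maxBothPowers y < maxSomePower y then 1
            else 0)) ∧
    (∀ n r : ℕ, 1 ≤ n → 0 < r → r < 2 ^ k →
      (binomComplexity (k + 1) (thueMorseMorphism^[k] y) (2 ^ k * n + r) : ℤ) =
        ((r : ℤ) - 1) * ((setX y (n + 1)).ncard : ℤ) +
          ((2 : ℤ) ^ k - (r : ℤ) - 1) * ((setX y n).ncard : ℤ) + ((setY y n).ncard : ℤ) -
          (if (n : ℕ∞) + 1 < maxBothPowers y then (2 : ℤ) ^ k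
            else if (n : ℕ∞) + 1 = maxBothPowers y ∧ maxBothPowers y < maxSomePower y then
              (2 : ℤ) ^ k - (r : ℤ) + 1
            else if (n : ℕ∞) + 1 = maxBothPowers y ∧ maxBothPowers y = maxSomePower y ∧
                r ≤ 2 ^ (k - 1) then
              (2 : ℤ) ^ k - 2 * ((r : ℤ) - 1)
            else 0)) := by
  classical
  obtain ⟨k, rfl⟩ := Nat.exists_eq_add_of_le' hk
  have hK := Nat.two_pow_pos (k + 1)
  have hK2 : 2 ^ (k + 1) = 2 * 2 ^ k := pow_succ' 2 k
  have hcast : ((2 : ℤ) ^ (k + 1)) = ((2 ^ (k + 1) : ℕ) : ℤ) := by push_cast; rfl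
  refine ⟨fun hy r hr => ?_, fun n hn => ?_, fun n r hn hr0 hr => ?_⟩
  · rw [binomComplexity_eq_factorComplexity_of_lt hr, factorComplexity,
      factors_eq_factors_thueMorseWord hy hr, factorComplexity]
  · have h := binomComplexity_add_special (k := k) (r := 0) hn y
    rw [card_filter_coverLen hn hK fun o ho => coverLen_zero ho, sum_ncard_windowData_zero _ hn,
      add_zero] at h
    have h' := congrArg (Nat.cast : ℕ → ℤ) h
    have hp := Nat.two_pow_pos k
    rw [hcast]
    push_cast [Nat.cast_sub hK] at h' ⊢
    rw [← h']
    -- With T = 0 the case m = m' contributes twice the truncated 1 - 2^k, which is 0.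
    split_ifs
    all_goals simp
    omega
  · have h := binomComplexity_add_special (k := k) (r := r) hn y
    rw [card_filter_coverLen (N := n + 1) (by omega) (by omega)
      fun o ho => coverLen_pos_eq ho hr0 hr, sum_ncard_windowData_pos hn hr0 hr] at h
    -- Replacing r - 1 and 2^(k+1) - r - 1 by variables removes the truncated subtractions before
    -- casting to ℤ.
    obtain ⟨d, hd⟩ := Nat.exists_eq_add_of_le (Nat.succ_le_of_lt hr)
    obtain ⟨r, rfl⟩ := Nat.exists_eq_add_of_le' (Nat.succ_le_of_lt hr0)
    rw [show r + 1 - 1 = r by omega, show 2 ^ (k + 1) - (r + 1) - 1 = d by omega] at h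
    have h' := congrArg (Nat.cast : ℕ → ℤ) h
    have e1 : (((r + 1 : ℕ) : ℤ) - 1) = r := by push_cast; ring
    have e2 : (((2 ^ (k + 1) : ℕ) : ℤ) - ((r + 1 : ℕ) : ℤ) - 1) = d := by omega
    rw [hcast, e1, e2, show k + 1 - 1 = k from rfl]
    simp only [Nat.cast_add, Nat.cast_mul, Nat.cast_one] at h' ⊢
    rw [← h', eq_sub_iff_add_eq, add_right_inj]
    by_cases c1 : (n : ℕ∞) + 1 < maxBothPowers y
    · simp only [c1, if_true]
    by_cases c2 : (n : ℕ∞) + 1 = maxBothPowers y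
    · rcases (maxBothPowers_le y).lt_or_eq with c3 | c3
      · simp only [c2, c3, lt_irrefl, if_true, if_false, and_self]
        omega
      -- This threshold decides whether the truncated T + 1 - 2^k, with T = 2^(k+1) - (r+1), is
      -- positive or 0.
      · by_cases c4 : r + 1 ≤ 2 ^ k
        · simp only [c2, c3, c4, lt_irrefl, if_true, if_false, and_self, and_false]
          omega
        · simp only [c2, c3, c4, lt_irrefl, if_true, if_false, and_self, and_false]
          omega
    · simp only [c1, c2, if_false, false_and]
      rfl
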